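/- **Model.** Let $J,L\ge 0$ be integers and let $\mathcal T=\{(j,k):0\le j\le J,\ 0\le k<2^j\}$ be the binary tree in which $(j,k)$ has the children $(j+1,2k)$ and $(j+1,2k+1)$. There are $L$ factors, factor $l$ having levels $1,\dots,G_l$; for each combination $g=(g_1,\dots,g_L)$ of levels there are $n_g$ observations, and $n=\sum_g n_g$. At each node the vector $d_{j,k}\in\mathbb R^n$ of the data (the empirical wavelet coefficients of the $n$ observations) satisfies $$d_{j,k}=X\theta_{j,k}+u_{j,k},\qquad \theta_{j,k}=\big(z_{j,k},\ (\beta_{l\,j,k}^{(g)})_{1\le l\le L,\ 2\le g\le G_l}\big)',$$ where $X=(\mathbb 1_n,(e^{(l)}_g)_{l,\,g\ge2})$, the $h$-th entry of $e^{(l)}_g$ is $1$ if the $h$-th observation has level $g$ of factor $l$ and $0$ otherwise, and, given all the unknowns, the entries of all $u_{j,k}$ are independent, those of $u_{j,k}$ being $\mathrm N(0,\sigma^2_{j,k})$. The prior, with hyperparameters $\alpha,\tau,\upsilon_1,\dots,\upsilon_L,\nu,\sigma_0>0$, $\tau_j=2^{-\alpha j}\tau$, $\upsilon^{(l)}_j=2^{-\alpha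 j}\upsilon_l$, is the $L$-factor normal-inverse-Gamma Markov grove. The hidden states $S_{j,k}\in\{0,1\}$ and $\mathbf R_{j,k}=(R_{1\,j,k},\dots,R_{L\,j,k})\in\{0,1\}^L$ form $L+1$ independent Markov trees: the tree of $S$ has initial probabilities $\rho_{0,0}(s)$ at the root and transition probabilities $\rho_{j,k}(s,s')$ from the parent $(j-1,\lfloor k/2\rfloor)$ to $(j,k)$, and each tree $R_l$ has initial probabilities $\kappa_{0,0}(r)$ and transition probabilities $\kappa_{j,k}(r,r')$. Given the hidden states, the pairs $(\sigma^2_{j,k},\theta_{j,k})$ are independent over the nodes, with $\sigma^2_{j,k}\sim\text{Inv-Gamma}(\nu+1,\nu\sigma_0^2)$ and, given $\sigma_{j,k}^2$, independent $z_{j,k}\sim\mathrm N(0,S_{j,k}\tau_j\sigma^2_{j,k})$ and $\beta^{(g)}_{l\,j,k}\sim\mathrm N(0,R_{l\,j,k}\upsilon^{(l)}_j\sigma^2_{j,k})$. Here $\text{Inv-Gamma}(a,b)$ has the density $\frac{b^a}{\Gamma(a)}x^{-a-1}e^{-b/x}$ on $x>0$, and $\mathrm N(0,0)$ is the point mass at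 $0$. **Notation.** For $(s,\mathbf r)\in\{0,1\}^{L+1}$ let $a(s,\mathbf r)=(s,(r_l)_{l,\,2\le g\le G_l})'$, $X(s,\mathbf r)=X\,\mathrm{diag}(a(s,\mathbf r))$, $M(s,\mathbf r)=a(s,\mathbf r)a(s,\mathbf r)'$, $\Lambda_j=\mathrm{diag}(1/\tau_j,(1/\upsilon^{(l)}_j)_{l,\,2\le g\le G_l})$, $$\Lambda_j^*(s,\mathbf r)=X(s,\mathbf r)'X(s,\mathbf r)+\Lambda_j,\qquad \mu^*_{j,k}(s,\mathbf r)=\Lambda_j^*(s,\mathbf r)^{-1}X(s,\mathbf r)'d_{j,k},$$ $$\Upsilon_{j,k}(s,\mathbf r)=\tfrac12\big\{d_{j,k}'d_{j,k}-\mu^*_{j,k}(s,\mathbf r)'\Lambda_j^*(s,\mathbf r)\mu^*_{j,k}(s,\mathbf r)\big\},$$ $$m_{j,k}(s,\mathbf r)=\frac{(\nu\sigma_0^2)^{\nu+1}\Gamma(\nu+\frac n2+1)}{(2\pi)^{n/2}\Gamma(\nu+1)}\cdot\frac{|\Lambda_j|^{1/2}}{|\Lambda_j^*(s,\mathbf r)|^{1/2}}\cdot\big[\nu\sigma_0^2+\Upsilon_{j,k}(s,\mathbf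 r)\big]^{-\nu-n/2-1}.$$ Define $\phi_{j,k},\xi_{j,k}:\{0,1\}^{L+1}\to[0,\infty)$ recursively, from $j=J$ down to $j=0$, by $$\phi_{j,k}(s,\mathbf r)=\begin{cases}m_{j,k}(s,\mathbf r)\,\xi_{j+1,2k}(s,\mathbf r)\,\xi_{j+1,2k+1}(s,\mathbf r)&j<J\\ m_{j,k}(s,\mathbf r)&j=J,\end{cases}$$ $$\xi_{j,k}(s,\mathbf r)=\begin{cases}\sum_{s',\mathbf r'}\rho_{j,k}(s,s')\prod_{l=1}^L\kappa_{j,k}(r_l,r_l')\,\phi_{j,k}(s',\mathbf r')&j\ge1\\ \sum_{s',\mathbf r'}\rho_{0,0}(s')\prod_{l=1}^L\kappa_{0,0}(r'_l)\,\phi_{0,0}(s',\mathbf r')&j=0.\end{cases}$$ **Theorem.** $m_{j,k}(s,\mathbf r)$ is the marginal likelihood of $d_{j,k}$ given $S_{j,k}=s$, $\mathbf R_{j,k}=\mathbf r$. For all data $\mathcal D=(d_{j,k})_{(j,k)\in\mathcal T}$, the posterior (prior times likelihood, normalized; for almost all $\mathcal D$ it is the conditional law of the unknowns given $\mathcal D$)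 is a probability measure, and it is as follows. * The hidden states $(S_{j,k},\mathbf R_{j,k})_{(j,k)\in\mathcal T}$ form a Markov tree on $\{0,1\}^{L+1}$ with transition probabilities, for $j\ge1$ (as conditional probabilities, whenever the conditioning event has positive posterior probability), $$\Pr(S_{j,k}=s',\mathbf R_{j,k}=\mathbf r'\mid S_{j-1,\lfloor k/2\rfloor}=s,\mathbf R_{j-1,\lfloor k/2\rfloor}=\mathbf r,\mathcal D)=\rho_{j,k}(s,s')\prod_{l=1}^L\kappa_{j,k}(r_l,r'_l)\cdot\frac{\phi_{j,k}(s',\mathbf r')}{\xi_{j,k}(s,\mathbf r)}$$ and initial probabilities $$\Pr(S_{0,0}=s,\mathbf R_{0,0}=\mathbf r\mid\mathcal D)=\rho_{0,0}(s)\prod_{l=1}^L\kappa_{0,0}(r_l)\cdot\frac{\phi_{0,0}(s,\mathbf r)}{\xi_{0,0}(0,\mathbf 0)}.$$ * $[\sigma^2_{j,k}\mid S_{j,k},\mathbf R_{j,k},\mathcal D]\sim\text{Inv-Gamma}\big(\nu+1+\frac n2,\ \nu\sigma_0^2+\Upsilon_{j,k}(S_{j,k},\mathbf R_{j,k})\big)$.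 * $[\theta_{j,k}\mid\sigma^2_{j,k},S_{j,k},\mathbf R_{j,k},\mathcal D]\sim\mathrm N\big(\mu^*_{j,k}(S_{j,k},\mathbf R_{j,k}),\ \sigma^2_{j,k}\,M(S_{j,k},\mathbf R_{j,k})\circ\Lambda_j^*(S_{j,k},\mathbf R_{j,k})^{-1}\big)$, where $\circ$ is the Hadamard product. * Given all hidden states and $\mathcal D$, the pairs $(\sigma^2_{j,k},\theta_{j,k})$, $(j,k)\in\mathcal T$, are independent, each with the law given by the two preceding items; together with the first item this determines the joint posterior. -/

import Mathlib

open MeasureTheory ProbabilityTheory Matrix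
open scoped ENNReal NNReal

/-! ### The bifurcating location-scale tree and Markov trees on it -/

/-- The nodes `(j, k)`, `0 ≤ j ≤ J`, `0 ≤ k < 2 ^ j`. -/
abbrev Node (J : ℕ) : Type := (j : Fin (J + 1)) × Fin (2 ^ (j : ℕ))

namespace Node

/-- The root `(0, 0)`. -/
def root (J : ℕ) : Node J := ⟨⟨0, Nat.succ_pos J⟩, ⟨0, Nat.two_pow_pos 0⟩⟩

/-- The parent `(j - 1, ⌊k / 2⌋)` of `(j, k)`; it is only used for `j ≥ 1`. -/
def parent {J : ℕ} (t : Node J) : Node J :=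
  ⟨⟨(t.1 : ℕ) - 1, by have := t.1.2; omega⟩, ⟨(t.2 : ℕ) / 2, by
    have h := t.2.2
    rcases Nat.eq_zero_or_pos (t.1 : ℕ) with h0 | h0
    · have h1 : (t.2 : ℕ) < 1 := by simpa [h0] using h
      have h2 : (t.2 : ℕ) / 2 = 0 := by omega
      rw [h2]; exact Nat.two_pow_pos _
    · have h1 : 2 ^ (t.1 : ℕ) = 2 ^ ((t.1 : ℕ) - 1) * 2 := by
        rw [← pow_succ, Nat.sub_add_cancel h0]
      change (t.2 : ℕ) / 2 < 2 ^ ((t.1 : ℕ) - 1)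
      omega⟩⟩

/-- The children `(j + 1, 2 k)` (for `b = 0`) and `(j + 1, 2 k + 1)` (for `b = 1`) of `(j, k)`. -/
def child {J : ℕ} (t : Node J) (h : (t.1 : ℕ) < J) (b : Fin 2) : Node J :=
  ⟨⟨(t.1 : ℕ) + 1, by omega⟩, ⟨2 * (t.2 : ℕ) + (b : ℕ), by
    have h1 := t.2.2
    have h2 := b.2
    change 2 * (t.2 : ℕ) + (b : ℕ) < 2 ^ ((t.1 : ℕ) + 1)
    rw [pow_succ]
    omega⟩⟩

end Node

/-- `init` is a probability vector and, at every node other than the root, `trans` is a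
stochastic matrix. -/
def IsStochastic {J : ℕ} {A : Type} [Fintype A] (init : A → ℝ) (trans : Node J → A → A → ℝ) :
    Prop :=
  (∀ a, 0 ≤ init a) ∧ (∑ a, init a = 1) ∧
    ∀ t : Node J, (t.1 : ℕ) ≠ 0 → ∀ a, (∀ a', 0 ≤ trans t a a') ∧ ∑ a', trans t a a' = 1

/-- The probability that the Markov tree with initial state probabilities `init` and state
transition probabilities `trans` gives to the configuration `c` of states. -/
noncomputable def markovTreeMass {J : ℕ} {A : Type} (init : A → ℝ) (trans : Node J → A → A → ℝ)
    (c : Node J → A) : ℝ :=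
  ∏ t : Node J, if (t.1 : ℕ) = 0 then init (c t) else trans t (c t.parent) (c t)

/-- The law of the Markov tree with the given initial and transition probabilities. -/
noncomputable def markovTree {J : ℕ} {A : Type} [Fintype A] [DecidableEq A] [MeasurableSpace A]
    (init : A → ℝ) (trans : Node J → A → A → ℝ) : Measure (Node J → A) :=
  ∑ c : Node J → A, ENNReal.ofReal (markovTreeMass init trans c) • Measure.dirac c

/-! ### The inverse-Gamma distribution -/

/-- The density `b ^ a / Γ(a) * x ^ (-a - 1) * exp (-b / x)`, `x > 0`, of `Inv-Gamma(a, b)`. -/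
noncomputable def invGammaPDF (a b x : ℝ) : ℝ≥0∞ :=
  if 0 < x then
    ENNReal.ofReal (b ^ a / Real.Gamma a * x ^ (-a - 1) * Real.exp (-b / x))
  else 0

/-- The distribution `Inv-Gamma(a, b)` with shape `a` and scale `b`. -/
noncomputable def invGamma (a b : ℝ) : Measure ℝ := volume.withDensity (invGammaPDF a b)

/-! ### The `L`-factor model -/

/-- The states `(s, r_1, …, r_L) ∈ {0,1}^{L+1}` of a node. -/
abbrev State (L : ℕ) : Type := Fin 2 × (Fin L → Fin 2)

/-- Design and hyperparameters of the normal-inverse-Gamma Markov grove with `L` factors on the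
location-scale tree of depth `J`. -/
structure NIGMG (J L : ℕ) where
  /-- `G l` is the number of levels of factor `l` -/
  G : Fin L → ℕ
  /-- `N g` is the number of observations for the factor combination `g` -/
  N : ((l : Fin L) → Fin (G l)) → ℕ
  α : ℝ
  τ : ℝ
  υ : Fin L → ℝ
  ν : ℝ
  σ₀ : ℝ
  /-- initial state probabilities of the Markov tree of the `S_{j,k}` -/
  ρ₀ : Fin 2 → ℝ
  /-- state transition probabilities of the Markov tree of the `S_{j,k}` -/
  ρ : Node J → Fin 2 → Fin 2 → ℝ
  /-- initial state probabilities of the Markov tree of the `R_{l,j,k}`, for each `l` -/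
  κ₀ : Fin 2 → ℝ
  /-- state transition probabilities of the Markov tree of the `R_{l,j,k}`, for each `l` -/
  κ : Node J → Fin 2 → Fin 2 → ℝ
  α_pos : 0 < α
  τ_pos : 0 < τ
  υ_pos : ∀ l, 0 < υ l
  ν_pos : 0 < ν
  σ₀_pos : 0 < σ₀
  ρ_stochastic : IsStochastic ρ₀ ρ
  κ_stochastic : IsStochastic κ₀ κ

namespace NIGMG

variable {J L : ℕ} (P : NIGMG J L)

/-- The observations `(g, i)`, `1 ≤ i ≤ n_g`. -/
abbrev Obs : Type := (g : (l : Fin L) → Fin (P.G l)) × Fin (P.N g)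

/-- The indices of the coefficients at a node: `none` stands for `z` and `some ⟨l, g⟩` for
`β_l^{(g)}`, where `g` runs through the levels of factor `l` other than the first (which, levels
being numbered from `0` here, is the level `0`). -/
abbrev Coef : Type := Option ((l : Fin L) × {g : Fin (P.G l) // (g : ℕ) ≠ 0})

/-- The space of the vectors `(z, β)` of coefficients at a node. -/
abbrev Theta : Type := EuclideanSpace ℝ P.Coef

/-- The unknowns: the hidden states `(S, R)` of all nodes, and the pairs `(σ², (z, β))` of all
nodes. -/
abbrev Param : Type := (Node J → State L) × (Node J → ℝ × P.Theta)

/-- The empirical wavelet coefficients of all observations at all nodes. -/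
abbrev Data : Type := Node J → P.Obs → ℝ

/-- The entry `s` or `r_l` of the state that switches a coefficient on or off. -/
def act (x : State L) : P.Coef → ℝ
  | none => ((x.1 : ℕ) : ℝ)
  | some c => ((x.2 c.1 : ℕ) : ℝ)

/-- The scaling parameters `τ_j = 2^{-α j} τ` and `υ_j^{(l)} = 2^{-α j} υ_l`. -/
noncomputable def scale (j : ℕ) : P.Coef → ℝ
  | none => (2 : ℝ) ^ (-P.α * (j : ℝ)) * P.τ
  | some c => (2 : ℝ) ^ (-P.α * (j : ℝ)) * P.υ c.1

/-- The design matrix `X`. -/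
def design : Matrix P.Obs P.Coef ℝ :=
  Matrix.of fun h c => match c with
    | none => 1
    | some c => if h.1 c.1 = c.2.1 then 1 else 0

/-! #### Prior and likelihood -/

/-- The prior law of the coefficients of a node at level `j` given its state and `σ² = v`:
independent, centred normal with variances `s τ_j v` and `r_l υ_j^{(l)} v`. -/
noncomputable def priorCoef (j : ℕ) (x : State L) (v : ℝ) : Measure P.Theta :=
  (Measure.pi fun c : P.Coef =>
    gaussianReal 0 (P.act x c * P.scale j c * v).toNNReal).map (WithLp.toLp 2)

/-- The prior law of `(σ², (z, β))` at a node given its state. -/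
noncomputable def priorNode (t : Node J) (x : State L) : Measure (ℝ × P.Theta) :=
  (invGamma (P.ν + 1) (P.ν * P.σ₀ ^ 2)).bind fun v => (P.priorCoef t.1 x v).map (Prod.mk v)

/-- The prior probability of a configuration of the hidden states: the `L + 1` trees are
independent Markov trees. -/
noncomputable def priorStates (c : Node J → State L) : ℝ :=
  markovTreeMass P.ρ₀ P.ρ (fun t => (c t).1) *
    ∏ l : Fin L, markovTreeMass P.κ₀ P.κ (fun t => (c t).2 l)

/-- The law of the unknowns under which the hidden states have the joint probabilities `w` and,
given the hidden states, the pairs `(σ², (z, β))` of the nodes are independent, that of a node `t`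
in state `x` having the law `node t x`. -/
noncomputable def grove (w : (Node J → State L) → ℝ)
    (node : Node J → State L → Measure (ℝ × P.Theta)) : Measure P.Param :=
  ∑ c : Node J → State L, ENNReal.ofReal (w c) •
    (Measure.dirac c).prod (Measure.pi fun t => node t (c t))

/-- The prior law of the unknowns. -/
noncomputable def prior : Measure P.Param := P.grove P.priorStates P.priorNode

/-- The law of the data given the unknowns: independent,
`d_{j,k}^{(g,i)} ~ N((X θ_{j,k})^{(g,i)}, σ_{j,k}²)`. -/
noncomputable def dataLaw (p : P.Param) : Measure P.Data :=
  Measure.pi fun t => Measure.pi fun h =>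
    gaussianReal ((P.design *ᵥ (p.2 t).2.ofLp) h) (p.2 t).1.toNNReal

/-- The likelihood of the vector `d` of the data at a node. -/
noncomputable def nodeLik (d : P.Obs → ℝ) (y : ℝ × P.Theta) : ℝ≥0∞ :=
  ∏ h, gaussianPDF ((P.design *ᵥ y.2.ofLp) h) y.1.toNNReal (d h)

/-- The likelihood of the data. -/
noncomputable def lik (D : P.Data) (p : P.Param) : ℝ≥0∞ := ∏ t, P.nodeLik (D t) (p.2 t)

/-- The posterior given the data `D`, by Bayes' formula: prior times likelihood, normalized. -/
noncomputable def bayes (D : P.Data) : Measure P.Param :=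
  (∫⁻ p, P.lik D p ∂P.prior)⁻¹ • P.prior.withDensity (P.lik D)

/-! #### The quantities in the posterior -/

/-- `X(s, r)`. -/
def designSel (x : State L) : Matrix P.Obs P.Coef ℝ :=
  Matrix.of fun h c => P.act x c * P.design h c

/-- `Λ_j`. -/
noncomputable def Lam (j : ℕ) : Matrix P.Coef P.Coef ℝ :=
  Matrix.diagonal fun c => 1 / P.scale j c

/-- `Λ_j^*(s, r)`. -/
noncomputable def LamStar (j : ℕ) (x : State L) : Matrix P.Coef P.Coef ℝ :=
  (P.designSel x)ᵀ * P.designSel x + P.Lam j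

/-- `μ_{j,k}^*(s, r)`, where `d` is the vector of the data at the node. -/
noncomputable def muStar (j : ℕ) (d : P.Obs → ℝ) (x : State L) : P.Coef → ℝ :=
  (P.LamStar j x)⁻¹ *ᵥ ((P.designSel x)ᵀ *ᵥ d)

/-- `Υ_{j,k}(s, r)`. -/
noncomputable def Ups (j : ℕ) (d : P.Obs → ℝ) (x : State L) : ℝ :=
  (d ⬝ᵥ d - P.muStar j d x ⬝ᵥ (P.LamStar j x *ᵥ P.muStar j d x)) / 2

/-- `M(s, r)`. -/
def maskMat (x : State L) : Matrix P.Coef P.Coef ℝ := Matrix.vecMulVec (P.act x) (P.act x)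

/-- The total number `n` of observations. -/
abbrev n : ℕ := Fintype.card P.Obs

/-- The closed form of the marginal likelihood `m_{j,k}(s, r)`. -/
noncomputable def marg (D : P.Data) (t : Node J) (x : State L) : ℝ :=
  (P.ν * P.σ₀ ^ 2) ^ (P.ν + 1) * Real.Gamma (P.ν + (P.n : ℝ) / 2 + 1) /
      ((2 * Real.pi) ^ ((P.n : ℝ) / 2) * Real.Gamma (P.ν + 1)) *
    (√(P.Lam t.1).det / √(P.LamStar t.1 x).det) *
    (P.ν * P.σ₀ ^ 2 + P.Ups t.1 (D t) x) ^ (-P.ν - (P.n : ℝ) / 2 - 1)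

/-- `ρ_{0,0}(s) ∏_l κ_{0,0}(r_l)`. -/
def initPr (x : State L) : ℝ := P.ρ₀ x.1 * ∏ l, P.κ₀ (x.2 l)

/-- `ρ_{j,k}(s, s') ∏_l κ_{j,k}(r_l, r_l')`. -/
def transPr (t : Node J) (x x' : State L) : ℝ := P.ρ t x.1 x'.1 * ∏ l, P.κ t (x.2 l) (x'.2 l)

/-- The map `φ_{j,k}`, computed from the finest level upwards; the two sums are the values
`ξ_{j+1,2k}(s, r)` and `ξ_{j+1,2k+1}(s, r)` of the map `xi` defined below. -/
noncomputable def phi (D : P.Data) (t : Node J) (x : State L) : ℝ :=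
  if h : (t.1 : ℕ) < J then
    P.marg D t x *
      (∑ x', P.transPr (t.child h 0) x x' * phi D (t.child h 0) x') *
      (∑ x', P.transPr (t.child h 1) x x' * phi D (t.child h 1) x')
  else P.marg D t x
termination_by J - (t.1 : ℕ)
decreasing_by all_goals (simp only [Node.child]; omega)

/-- The map `ξ_{j,k}`. -/
noncomputable def xi (D : P.Data) (t : Node J) (x : State L) : ℝ :=
  if (t.1 : ℕ) = 0 then ∑ x', P.initPr x' * P.phi D t x'
  else ∑ x', P.transPr t x x' * P.phi D t x'

/-- `ρ_{0,0}(s) ∏_l κ_{0,0}(r_l) φ_{0,0}(s, r) / ξ_{0,0}(0, 0)`. -/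
noncomputable def postInit (D : P.Data) (x : State L) : ℝ :=
  P.initPr x * P.phi D (Node.root J) x / P.xi D (Node.root J) (0, 0)

/-- `ρ_{j,k}(s, s') ∏_l κ_{j,k}(r_l, r_l') φ_{j,k}(s', r') / ξ_{j,k}(s, r)`. -/
noncomputable def postTrans (D : P.Data) (t : Node J) (x x' : State L) : ℝ :=
  P.transPr t x x' * P.phi D t x' / P.xi D t x

/-- `Inv-Gamma(ν + 1 + n / 2, ν σ₀² + Υ_{j,k}(s, r))`. -/
noncomputable def postVar (D : P.Data) (t : Node J) (x : State L) : Measure ℝ :=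
  invGamma (P.ν + 1 + (P.n : ℝ) / 2) (P.ν * P.σ₀ ^ 2 + P.Ups t.1 (D t) x)

/-- `N(μ_{j,k}^*(s, r), v M(s, r) ∘ Λ_j^*(s, r)⁻¹)`. -/
noncomputable def postCoef (D : P.Data) (t : Node J) (x : State L) (v : ℝ) : Measure P.Theta :=
  multivariateGaussian (WithLp.toLp 2 (P.muStar t.1 (D t) x))
    (v • (P.maskMat x ⊙ (P.LamStar t.1 x)⁻¹))

/-- The law of `(σ², (z, β))` composed of `postVar` and `postCoef`. -/
noncomputable def postNode (D : P.Data) (t : Node J) (x : State L) : Measure (ℝ × P.Theta) :=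
  (P.postVar D t x).bind fun v => (P.postCoef D t x v).map (Prod.mk v)

end NIGMG

/-! ### Measurability and finiteness, needed for Mathlib's posterior kernel -/

theorem measurable_pi_measure {Ω ι : Type*} [MeasurableSpace Ω] [Fintype ι] {B : ι → Type*}
    [∀ i, MeasurableSpace (B i)] (μ : Ω → (i : ι) → Measure (B i))
    [∀ ω i, IsProbabilityMeasure (μ ω i)] (hμ : ∀ i, Measurable fun ω => μ ω i) :
    Measurable fun ω => Measure.pi (μ ω) := by
  refine Measurable.measure_of_isPiSystem_of_isProbabilityMeasure generateFrom_pi.symm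
    isPiSystem_pi ?_
  rintro _ ⟨s, hs, rfl⟩
  simp only [Measure.pi_pi]
  refine Finset.measurable_prod _ fun i _ => ?_
  exact (Measure.measurable_coe (hs i (Set.mem_univ i))).comp (hμ i)

theorem isFiniteMeasure_invGamma {a b : ℝ} (ha : 0 < a) (hb : 0 < b) :
    IsFiniteMeasure (invGamma a b) := by
  have h1 : IntegrableOn (fun y : ℝ => y ^ (a - 1) * Real.exp (-b * y)) (Set.Ioi 0) := by
    have := integrableOn_rpow_mul_exp_neg_mul_rpow (p := 1) (s := a - 1) (by linarith) one_pos hb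
    simpa using this
  have h2 := (integrableOn_Ioi_comp_rpow_iff' _ (p := -1) (by norm_num)).mpr h1
  have h3 : IntegrableOn
      (fun x : ℝ => b ^ a / Real.Gamma a * x ^ (-a - 1) * Real.exp (-b / x)) (Set.Ioi 0) := by
    refine IntegrableOn.congr_fun (h2.const_mul (b ^ a / Real.Gamma a)) (fun x hx => ?_)
      measurableSet_Ioi
    have hx0 : (0 : ℝ) < x := hx
    simp only [smul_eq_mul]
    rw [← Real.rpow_mul hx0.le, ← mul_assoc (x ^ _), ← Real.rpow_add hx0, Real.rpow_neg_one,
      ← mul_assoc, ← div_eq_mul_inv]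
    congr 3
    ring
  have h4 : (invGammaPDF a b) = (Set.Ioi (0 : ℝ)).indicator fun x =>
      ENNReal.ofReal (b ^ a / Real.Gamma a * x ^ (-a - 1) * Real.exp (-b / x)) := by
    ext x
    simp only [invGammaPDF, Set.indicator, Set.mem_Ioi]
  refine isFiniteMeasure_withDensity ?_
  rw [h4, lintegral_indicator measurableSet_Ioi]
  exact h3.lintegral_lt_top.ne

namespace NIGMG

variable {J L : ℕ} (P : NIGMG J L)

instance instIsProbabilityMeasurePriorCoef (j : ℕ) (x : State L) (v : ℝ) :
    IsProbabilityMeasure (P.priorCoef j x v) :=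
  Measure.isProbabilityMeasure_map (by fun_prop)

theorem measurable_priorCoef (j : ℕ) (x : State L) : Measurable (P.priorCoef j x) := by
  refine (Measure.measurable_map _ (by fun_prop)).comp (measurable_pi_measure _ fun c => ?_)
  exact measurable_gaussianReal.comp (measurable_const.prodMk (by fun_prop))

theorem measurable_priorCoef_map (j : ℕ) (x : State L) :
    Measurable fun v => (P.priorCoef j x v).map (Prod.mk v) := by
  let k : Kernel ℝ P.Theta := ⟨P.priorCoef j x, P.measurable_priorCoef j x⟩
  have : IsMarkovKernel k := ⟨fun v => P.instIsProbabilityMeasurePriorCoef j x v⟩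
  have h : (fun v => (P.priorCoef j x v).map (Prod.mk v)) =
      fun v => (Kernel.id ×ₖ k) v := by
    ext1 v
    rw [Kernel.prod_apply, Kernel.id_apply, Measure.dirac_prod]
    rfl
  rw [h]
  exact (Kernel.id ×ₖ k).measurable

instance instIsFiniteMeasurePriorNode (t : Node J) (x : State L) :
    IsFiniteMeasure (P.priorNode t x) := by
  have := isFiniteMeasure_invGamma (a := P.ν + 1) (b := P.ν * P.σ₀ ^ 2)
    (by have := P.ν_pos; linarith) (mul_pos P.ν_pos (pow_pos P.σ₀_pos 2))
  refine ⟨?_⟩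
  rw [priorNode, Measure.bind_apply MeasurableSet.univ
    (P.measurable_priorCoef_map _ x).aemeasurable]
  have h : ∀ v, (P.priorCoef t.1 x v).map (Prod.mk v) Set.univ = 1 := fun v => by
    rw [Measure.map_apply measurable_prodMk_left MeasurableSet.univ, Set.preimage_univ,
      measure_univ]
  simp only [h, lintegral_const, one_mul]
  exact measure_lt_top _ _

instance instIsFiniteMeasurePrior : IsFiniteMeasure P.prior := by
  refine ⟨?_⟩
  rw [prior, grove, Measure.finsetSum_apply]
  refine ENNReal.sum_lt_top.mpr fun c _ => ?_
  rw [Measure.smul_apply, smul_eq_mul]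
  exact ENNReal.mul_lt_top ENNReal.ofReal_lt_top (measure_lt_top _ _)

instance instIsFiniteMeasureBayes (D : P.Data) : IsFiniteMeasure (P.bayes D) := by
  refine ⟨?_⟩
  rw [bayes, Measure.smul_apply, withDensity_apply _ MeasurableSet.univ, Measure.restrict_univ,
    smul_eq_mul]
  exact (ENNReal.inv_mul_le_one _).trans_lt ENNReal.one_lt_top

instance instStandardBorelSpaceParam : StandardBorelSpace P.Param := by
  have h1 : StandardBorelSpace (State L) := inferInstance
  have h2 : StandardBorelSpace P.Theta := inferInstance
  infer_instance

theorem measurable_dataLaw : Measurable P.dataLaw := by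
  refine measurable_pi_measure _ fun t => measurable_pi_measure _ fun h => ?_
  refine measurable_gaussianReal.comp (Measurable.prodMk ?_ (by fun_prop))
  change Measurable fun p : P.Param => ∑ c, P.design h c * (p.2 t).2.ofLp c
  fun_prop

/-- The law of the data given the unknowns, as a Markov kernel. -/
noncomputable def likelihood : Kernel P.Param P.Data := ⟨P.dataLaw, P.measurable_dataLaw⟩

instance instIsMarkovKernelLikelihood : IsMarkovKernel P.likelihood :=
  ⟨fun p => by
    change IsProbabilityMeasure (P.dataLaw p)
    unfold dataLaw
    infer_instance⟩

end NIGMG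

/-! ### Products and densities -/

section PiMeasure

variable {ι : Type*} [Fintype ι]

/-! The posterior is computed by conjugacy at each node, followed by a sum over the hidden states
along the tree.

At one node with state `x`, the masked prior is the image of a nondegenerate normal vector under
`diagonal (P.act x)`, and the likelihood sees that vector only through the design `P.designSel x`.
For fixed variance `v` this is a ridge-type regression: completing the square
(`regression_sum_of_squares`) factors prior times likelihood into a normal density and a remainder
proportional to `v ^ (-n / 2) * exp (-Υ / v)`. Pushing the normal law through the mask gives the
Hadamard covariance (`priorCoef_withDensity_nodeLik`). The remainder is absorbed by the
inverse-Gamma density, and the constant left over is `marg` (`invGammaPDF_mul_evidence`,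
`priorNode_withDensity_nodeLik`).

Nodes are independent given the hidden states, so the likelihood multiplies the weight of a
configuration `c` by `∏ t, P.marg D t (c t)`. It remains to recognize these weights as a Markov
tree. The `L + 1` independent trees form a single tree on the product state space, and in the
product of the claimed transition probabilities every `ξ` except the one at the root cancels against
the `ξ`'s inside the `φ`'s (`prod_phi`, `markovTreeMass_post`). The surviving root value is the
evidence of the whole data set, and it is positive for all data; hence `bayes_eq_grove`. The
conditional laws are read off from this mixture representation, and Mathlib's posterior kernel is
identified through the joint law of data and unknowns (`posterior_ae_eq_of_withDensity`). -/

theorem lintegral_fin_pi_prod {n : ℕ} {E : Fin n → Type*} [∀ i, MeasurableSpace (E i)]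
    (μ : (i : Fin n) → Measure (E i)) [∀ i, SigmaFinite (μ i)] {f : (i : Fin n) → E i → ℝ≥0∞}
    (hf : ∀ i, Measurable (f i)) :
    ∫⁻ x, ∏ i, f i (x i) ∂(Measure.pi μ) = ∏ i, ∫⁻ x, f i x ∂(μ i) := by
  induction n with
  | zero => simp
  | succ n ih =>
    calc
      _ = ∫⁻ x : E 0 × ((i : Fin n) → E (Fin.succ i)),
          f 0 x.1 * ∏ i : Fin n, f (Fin.succ i) (x.2 i)
          ∂((μ 0).prod (Measure.pi (fun i ↦ μ i.succ))) := by
        refine (((measurePreserving_piFinSuccAbove μ 0).symm).lintegral_comp_emb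
          (MeasurableEquiv.measurableEmbedding _) _).symm.trans (lintegral_congr fun x => ?_)
        rw [Fin.prod_univ_succ]
        rfl
      _ = (∫⁻ x, f 0 x ∂μ 0)
          * ∏ i : Fin n, ∫⁻ (x : E (Fin.succ i)), f (Fin.succ i) x ∂(μ i.succ) := by
        rw [← ih _ (fun i => hf i.succ)]
        refine lintegral_prod_mul (f := f 0)
          (g := fun y : (i : Fin n) → E i.succ => ∏ i, f (Fin.succ i) (y i)) (hf 0).aemeasurable
          (Measurable.aemeasurable ?_)
        exact Finset.measurable_prod _ fun i _ => (hf _).comp (measurable_pi_apply i)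
      _ = ∏ i, ∫⁻ x, f i x ∂(μ i) := by rw [Fin.prod_univ_succ]

theorem lintegral_pi_prod {E : ι → Type*} [∀ i, MeasurableSpace (E i)]
    (μ : (i : ι) → Measure (E i)) [∀ i, SigmaFinite (μ i)] {f : (i : ι) → E i → ℝ≥0∞}
    (hf : ∀ i, Measurable (f i)) :
    ∫⁻ x, ∏ i, f i (x i) ∂(Measure.pi μ) = ∏ i, ∫⁻ x, f i x ∂(μ i) := by
  let e := (Fintype.equivFin ι).symm
  rw [← (measurePreserving_piCongrLeft _ e).lintegral_comp_emb
    (MeasurableEquiv.measurableEmbedding _)]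
  simp_rw [← e.prod_comp, MeasurableEquiv.coe_piCongrLeft, Equiv.piCongrLeft_apply_apply]
  exact lintegral_fin_pi_prod _ fun i => hf (e i)

/-- If every factor times its density is a multiple of `ν i`, then the product measure times the
product density is the corresponding multiple of the product of the `ν i`. -/
theorem pi_withDensity_prod_eq_smul_pi {E : ι → Type*} [∀ i, MeasurableSpace (E i)]
    (μ ν : (i : ι) → Measure (E i)) [∀ i, SigmaFinite (μ i)] [∀ i, SigmaFinite (ν i)]
    {f : (i : ι) → E i → ℝ≥0∞} (hf : ∀ i, Measurable (f i)) (c : ι → ℝ≥0)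
    (h : ∀ i, (μ i).withDensity (f i) = (c i : ℝ≥0∞) • ν i) :
    (Measure.pi μ).withDensity (fun x => ∏ i, f i (x i)) =
      (∏ i, (c i : ℝ≥0∞)) • Measure.pi ν := by
  have h1 : Measure.pi (fun i => c i • ν i) =
      (Measure.pi μ).withDensity (fun x => ∏ i, f i (x i)) := by
    refine Measure.pi_eq fun s hs => ?_
    rw [withDensity_apply _ (MeasurableSet.univ_pi hs), Measure.restrict_pi_pi,
      lintegral_pi_prod _ hf]
    refine Finset.prod_congr rfl fun i _ => ?_
    rw [← withDensity_apply _ (hs i), h i]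
    rfl
  have h2 : Measure.pi (fun i => c i • ν i) = (∏ i, (c i : ℝ≥0∞)) • Measure.pi ν := by
    refine Measure.pi_eq fun s _ => ?_
    rw [Measure.smul_apply, Measure.pi_pi, smul_eq_mul, ← Finset.prod_mul_distrib]
    rfl
  rw [← h1, h2]

theorem pi_withDensity_eq {E : ι → Type*} [∀ i, MeasurableSpace (E i)]
    (μ ν : (i : ι) → Measure (E i)) [∀ i, SigmaFinite (μ i)] [∀ i, SigmaFinite (ν i)]
    {f : (i : ι) → E i → ℝ≥0∞} (hf : ∀ i, Measurable (f i))
    (h : ∀ i, ν i = (μ i).withDensity (f i)) :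
    Measure.pi ν = (Measure.pi μ).withDensity (fun x => ∏ i, f i (x i)) := by
  simpa using (pi_withDensity_prod_eq_smul_pi μ ν hf (fun _ => 1) (by simp [h])).symm

theorem map_withDensity_comp {α β : Type*} [MeasurableSpace α] [MeasurableSpace β]
    (μ : Measure α) {g : α → β} (hg : Measurable g) {f : β → ℝ≥0∞} (hf : Measurable f) :
    (μ.map g).withDensity f = (μ.withDensity (f ∘ g)).map g := by
  ext s hs
  rw [withDensity_apply _ hs, Measure.map_apply hg hs, withDensity_apply _ (hg hs),
    setLIntegral_map hs hf hg]
  rfl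

end PiMeasure

/-! ### The inverse-Gamma distribution -/

theorem measurable_invGammaPDF (a b : ℝ) : Measurable (invGammaPDF a b) := by
  unfold invGammaPDF
  refine Measurable.ite measurableSet_Ioi ?_ measurable_const
  fun_prop

/-- The density vanishes off the positive half-line. The normal formulas below are valid only for
positive variance, and this makes the exceptional set null. -/
theorem ae_pos_invGamma (a b : ℝ) : ∀ᵐ v ∂(invGamma a b), 0 < v := by
  rw [invGamma, ae_withDensity_iff (measurable_invGammaPDF a b)]
  refine Filter.Eventually.of_forall fun v hv => ?_
  by_contra h
  exact hv (by simp [invGammaPDF, h])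

theorem isProbabilityMeasure_invGamma {a b : ℝ} (ha : 0 < a) (hb : 0 < b) :
    IsProbabilityMeasure (invGamma a b) := by
  have h1 : ∫ x in Set.Ioi (0 : ℝ), b ^ a / Real.Gamma a * x ^ (-a - 1) * Real.exp (-b / x) = 1 := by
    -- The substitution `y = 1 / x` turns the integral into a Gamma integral.
    have h2 := integral_comp_rpow_Ioi (fun y : ℝ => y ^ (a - 1) * Real.exp (-(b * y)))
      (p := -1) (by norm_num)
    rw [Real.integral_rpow_mul_exp_neg_mul_Ioi ha hb] at h2
    have h3 : ∫ x in Set.Ioi (0 : ℝ), x ^ (-a - 1) * Real.exp (-b / x) =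
        (1 / b) ^ a * Real.Gamma a := by
      rw [← h2]
      refine setIntegral_congr_fun measurableSet_Ioi fun x hx => ?_
      have hx0 : (0 : ℝ) < x := hx
      simp only [smul_eq_mul, abs_neg, abs_one, one_mul]
      rw [← Real.rpow_mul hx0.le, ← mul_assoc, ← Real.rpow_add hx0, Real.rpow_neg_one]
      congr 2
      · ring
      · rw [neg_div, div_eq_mul_inv]
    simp_rw [mul_assoc]
    rw [integral_const_mul, h3, one_div, Real.inv_rpow hb.le]
    have := (Real.rpow_pos_of_pos hb a).ne'
    have := (Real.Gamma_pos_of_pos ha).ne'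
    field_simp
  have h4 : (invGammaPDF a b) = (Set.Ioi (0 : ℝ)).indicator fun x =>
      ENNReal.ofReal (b ^ a / Real.Gamma a * x ^ (-a - 1) * Real.exp (-b / x)) := by
    ext x
    simp only [invGammaPDF, Set.indicator, Set.mem_Ioi]
  refine ⟨?_⟩
  rw [invGamma, withDensity_apply _ MeasurableSet.univ, Measure.restrict_univ, h4,
    lintegral_indicator measurableSet_Ioi, ← ofReal_integral_eq_lintegral_ofReal, h1,
    ENNReal.ofReal_one]
  -- A non-integrable function has Bochner integral `0` by convention, so the value `1` already
  -- forces integrability.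
  · exact Integrable.of_integral_ne_zero (by rw [h1]; norm_num)
  · refine (ae_restrict_mem measurableSet_Ioi).mono fun x hx => ?_
    have hx0 : (0 : ℝ) < x := hx
    have := Real.Gamma_pos_of_pos ha
    positivity

/-! ### Multivariate normal distributions -/

section Gaussian

variable {ι : Type*} [Fintype ι] [DecidableEq ι]

theorem prod_gaussianPDF_zero_one {ι : Type*} [Fintype ι] (x : ι → ℝ) :
    ∏ i, gaussianPDF 0 1 (x i) =
      ENNReal.ofReal ((√(2 * Real.pi))⁻¹ ^ Fintype.card ι * Real.exp (-(x ⬝ᵥ x) / 2)) := by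
  simp only [gaussianPDF]
  rw [← ENNReal.ofReal_prod_of_nonneg fun i _ => gaussianPDFReal_nonneg _ _ _]
  congr 1
  simp only [gaussianPDFReal, NNReal.coe_one, mul_one, sub_zero]
  rw [Finset.prod_mul_distrib, Finset.prod_const, ← Real.exp_sum, Finset.card_univ,
    ← Finset.sum_div, Finset.sum_neg_distrib]
  simp [dotProduct, sq]

open scoped MatrixOrder in
/-- The density of the normal distribution with mean `m` and precision matrix `Q`. -/
theorem multivariateGaussian_inv_eq_map_withDensity {Q : Matrix ι ι ℝ} (hQ : Q.PosDef)
    (m : ι → ℝ) :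
    multivariateGaussian (WithLp.toLp 2 m) Q⁻¹ =
      ((volume : Measure (ι → ℝ)).withDensity fun y => ENNReal.ofReal
        (√Q.det * (√(2 * Real.pi))⁻¹ ^ Fintype.card ι *
          Real.exp (-((y - m) ⬝ᵥ Q *ᵥ (y - m)) / 2))).map (WithLp.toLp 2) := by
  -- The multivariate normal law is by definition the image of the standard one under `x ↦ m + A x`;
  -- the density comes from this change of variables.
  set A : Matrix ι ι ℝ := CFC.sqrt Q⁻¹ with hA
  have hAA : A * A = Q⁻¹ := CFC.sqrt_mul_sqrt_self _ hQ.inv.posSemidef.nonneg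
  have hAT : Aᵀ = A := by
    have h := (CFC.sqrt_nonneg Q⁻¹).isSelfAdjoint
    rw [IsSelfAdjoint, star_eq_conjTranspose, conjTranspose_eq_transpose_of_trivial] at h
    exact h
  have hQdet : IsUnit Q.det := hQ.det_pos.ne'.isUnit
  have hdet : A.det * A.det * Q.det = 1 := by
    rw [← det_mul, hAA, ← det_mul, nonsing_inv_mul _ hQdet, det_one]
  have hA0 : A.det ≠ 0 := by
    intro h
    simp [h] at hdet
  -- This identity turns the quadratic form of `Q` at `m + A x` into `x ⬝ᵥ x`. It follows from `A *
  -- A = Q⁻¹` because one-sided inverses of square matrices are two-sided.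
  have hAQA : A * Q * A = 1 := by
    have h1 : A * (A * Q) = 1 := by rw [← mul_assoc, hAA, nonsing_inv_mul _ hQdet]
    exact mul_eq_one_comm.mp h1
  have habs : |A.det|⁻¹ = √Q.det := by
    rw [eq_comm, Real.sqrt_eq_iff_mul_self_eq hQ.det_pos.le (by positivity), ← mul_inv,
      ← abs_mul, abs_mul_self]
    exact (inv_eq_of_mul_eq_one_right hdet).symm
  set e : (ι → ℝ) → (ι → ℝ) := fun x => m + A *ᵥ x with he
  have hem : Measurable e := by
    refine measurable_const.add ?_
    exact (Continuous.matrix_mulVec continuous_const continuous_id).measurable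
  have hvol : (volume : Measure (ι → ℝ)).map e = ENNReal.ofReal (√Q.det) • volume := by
    have h1 : e = (fun y => m + y) ∘ (toLin' A) := rfl
    rw [h1, ← Measure.map_map (measurable_const_add m) (LinearMap.continuous_on_pi _).measurable,
      Real.map_matrix_volume_pi_eq_smul_volume_pi hA0, Measure.map_smul,
      (measurePreserving_add_left volume m).map_eq, abs_inv, habs]
  set g : (ι → ℝ) → ℝ≥0∞ := fun y => ENNReal.ofReal ((√(2 * Real.pi))⁻¹ ^ Fintype.card ι *
    Real.exp (-((y - m) ⬝ᵥ Q *ᵥ (y - m)) / 2)) with hg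
  have hgm : Measurable g := by
    have : Continuous fun y : ι → ℝ => (y - m) ⬝ᵥ Q *ᵥ (y - m) :=
      Continuous.dotProduct (by fun_prop)
        (Continuous.matrix_mulVec continuous_const (by fun_prop))
    exact ENNReal.measurable_ofReal.comp (Continuous.measurable (by fun_prop))
  have hpi : Measure.pi (fun _ : ι => gaussianReal 0 1) =
      (volume : Measure (ι → ℝ)).withDensity (g ∘ e) := by
    rw [pi_withDensity_eq (fun _ => volume) _ (fun _ => measurable_gaussianPDF 0 1)
      (fun _ => gaussianReal_of_var_ne_zero 0 one_ne_zero), ← volume_pi]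
    congr 1
    ext x
    rw [prod_gaussianPDF_zero_one]
    simp only [hg, he, Function.comp, add_sub_cancel_left]
    congr 4
    rw [mulVec_mulVec, dotProduct_mulVec, vecMul_mulVec, hAT, ← mul_assoc, hAQA,
      vecMul_one]
  rw [multivariateGaussian, ← map_pi_eq_stdGaussian, Measure.map_map (by fun_prop) (by fun_prop)]
  have hcomp : (fun x => WithLp.toLp 2 m + toEuclideanCLM (𝕜 := ℝ) (CFC.sqrt Q⁻¹) x) ∘
      (WithLp.toLp 2) = (WithLp.toLp 2) ∘ e := by
    ext1 x
    simp [he, hA]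
  rw [hcomp, ← Measure.map_map (by fun_prop) hem, hpi, ← map_withDensity_comp _ hem hgm, hvol,
    withDensity_smul_measure, ← withDensity_smul _ hgm]
  congr 2
  ext y
  simp only [Pi.smul_apply, smul_eq_mul, hg]
  rw [← ENNReal.ofReal_mul (Real.sqrt_nonneg _), mul_assoc]

/-- Comparing characteristic functions avoids densities, so `B` may be singular. This is essential
because `B` will be a 0/1 diagonal mask. -/
theorem multivariateGaussian_map_toEuclideanCLM (m : EuclideanSpace ℝ ι) {S : Matrix ι ι ℝ}
    (hS : S.PosSemidef) (B : Matrix ι ι ℝ) :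
    (multivariateGaussian m S).map (toEuclideanCLM (𝕜 := ℝ) B) =
      multivariateGaussian (toEuclideanCLM (𝕜 := ℝ) B m) (B * S * Bᵀ) := by
  have hS' : (B * S * Bᵀ).PosSemidef := by
    simpa [conjTranspose_eq_transpose_of_trivial] using hS.mul_mul_conjTranspose_same B
  have hin : ∀ x y : EuclideanSpace ℝ ι, inner ℝ (toEuclideanCLM (𝕜 := ℝ) B x) y =
      inner ℝ x (toEuclideanCLM (𝕜 := ℝ) Bᵀ y) := by
    intro x y
    rw [real_inner_comm, inner_toEuclideanCLM, inner_toEuclideanCLM, dotProduct_mulVec,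
      ← mulVec_transpose, dotProduct_comm]
  have : IsProbabilityMeasure ((multivariateGaussian m S).map (toEuclideanCLM (𝕜 := ℝ) B)) :=
    Measure.isProbabilityMeasure_map (by fun_prop)
  refine Measure.ext_of_charFun ?_
  ext t
  rw [charFun_multivariateGaussian hS', charFun_apply, integral_map (by fun_prop) (by fun_prop)]
  simp_rw [hin]
  rw [← charFun_apply, charFun_multivariateGaussian hS, real_inner_comm, ← hin, real_inner_comm]
  congr 4
  rw [ofLp_toEuclideanCLM, mulVec_mulVec, dotProduct_mulVec, mulVec_transpose, vecMul_vecMul, ← mul_assoc,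
    ← dotProduct_mulVec]

end Gaussian

/-! ### Normal linear regression with a normal prior -/

section Regression

variable {ι η : Type*} [Fintype ι] [DecidableEq ι] [Fintype η]

theorem posDef_diagonal_one_div {ι : Type*} [DecidableEq ι] {s : ι → ℝ} (hs : ∀ c, 0 < s c) :
    (diagonal fun c => 1 / s c).PosDef :=
  PosDef.diagonal fun c => one_div_pos.mpr (hs c)

theorem posDef_gram_add_diagonal {s : ι → ℝ} (hs : ∀ c, 0 < s c) (X : Matrix η ι ℝ) :
    (Xᵀ * X + diagonal fun c => 1 / s c).PosDef := by
  have h := posSemidef_conjTranspose_mul_self X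
  rw [conjTranspose_eq_transpose_of_trivial] at h
  exact (posDef_diagonal_one_div hs).posSemidef_add h

/-- Completing the square. -/
theorem regression_sum_of_squares {s : ι → ℝ} (hs : ∀ c, 0 < s c) (X : Matrix η ι ℝ)
    {Q : Matrix ι ι ℝ} (hQ : Q = Xᵀ * X + diagonal fun c => 1 / s c) (d : η → ℝ)
    {μ : ι → ℝ} (hμ : μ = Q⁻¹ *ᵥ (Xᵀ *ᵥ d)) (θ : ι → ℝ) :
    ∑ c, θ c ^ 2 / s c + ∑ h, (d h - (X *ᵥ θ) h) ^ 2 =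
      (θ - μ) ⬝ᵥ Q *ᵥ (θ - μ) + (d ⬝ᵥ d - μ ⬝ᵥ (Q *ᵥ μ)) := by
  have hpd : Q.PosDef := hQ ▸ posDef_gram_add_diagonal hs X
  have hQμ : Q *ᵥ μ = Xᵀ *ᵥ d := by
    rw [hμ, mulVec_mulVec, mul_nonsing_inv _ hpd.det_pos.ne'.isUnit, one_mulVec]
  have hsymm : μ ⬝ᵥ (Q *ᵥ θ) = (Q *ᵥ μ) ⬝ᵥ θ := by
    have hT : Qᵀ = Q := by
      simpa [conjTranspose_eq_transpose_of_trivial] using hpd.isHermitian.eq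
    rw [dotProduct_mulVec, ← mulVec_transpose, hT]
  have h1 : (Q *ᵥ μ) ⬝ᵥ θ = d ⬝ᵥ (X *ᵥ θ) := by
    rw [hQμ, mulVec_transpose, ← dotProduct_mulVec]
  have h2 : θ ⬝ᵥ (Q *ᵥ θ) = (X *ᵥ θ) ⬝ᵥ (X *ᵥ θ) + ∑ c, θ c ^ 2 / s c := by
    rw [hQ, add_mulVec, dotProduct_add, ← mulVec_mulVec, dotProduct_mulVec, vecMul_transpose]
    congr 1
    simp only [dotProduct, mulVec_diagonal]
    exact Finset.sum_congr rfl fun c _ => by ring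
  have h3 : ∑ h, (d h - (X *ᵥ θ) h) ^ 2 =
      d ⬝ᵥ d - 2 * (d ⬝ᵥ (X *ᵥ θ)) + (X *ᵥ θ) ⬝ᵥ (X *ᵥ θ) := by
    simp only [dotProduct, Finset.mul_sum]
    rw [← Finset.sum_sub_distrib, ← Finset.sum_add_distrib]
    exact Finset.sum_congr rfl fun c _ => by ring
  rw [h3, mulVec_sub, dotProduct_sub, sub_dotProduct, sub_dotProduct, hsymm, h2,
    dotProduct_comm θ (Q *ᵥ μ), h1]
  ring

/-- Completing the square at `θ = μ` kills the quadratic form and leaves the residual as a sum of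
squares. -/
theorem regression_residual_nonneg {s : ι → ℝ} (hs : ∀ c, 0 < s c) (X : Matrix η ι ℝ)
    {Q : Matrix ι ι ℝ} (hQ : Q = Xᵀ * X + diagonal fun c => 1 / s c) (d : η → ℝ)
    {μ : ι → ℝ} (hμ : μ = Q⁻¹ *ᵥ (Xᵀ *ᵥ d)) :
    0 ≤ (d ⬝ᵥ d - μ ⬝ᵥ (Q *ᵥ μ)) / 2 := by
  have h := regression_sum_of_squares hs X hQ d hμ μ
  rw [sub_self, zero_dotProduct, zero_add] at h
  rw [← h]
  have : ∀ c, 0 ≤ μ c ^ 2 / s c := fun c => div_nonneg (sq_nonneg _) (hs c).le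
  exact div_nonneg (add_nonneg (Finset.sum_nonneg fun c _ => this c)
    (Finset.sum_nonneg fun h _ => sq_nonneg _)) zero_le_two

/-- The factor by which prior times likelihood exceeds the density of the posterior, in a normal
linear regression with error variance `v`. -/
noncomputable def regressionEvidence (n : ℕ) (detPrior detPost u v : ℝ) : ℝ :=
  (√(2 * Real.pi * v))⁻¹ ^ n * (√detPrior / √detPost) * Real.exp (-u / v)

/-- The exponents combine by completing the square. The powers of `2π` and `v` normalizing the prior
are those normalizing the posterior, so only the ratio of determinant roots and the normalization of
the likelihood remain in the evidence. -/
theorem prior_mul_likelihood_density {s : ι → ℝ} (hs : ∀ c, 0 < s c) (X : Matrix η ι ℝ)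
    {Q : Matrix ι ι ℝ} (hQ : Q = Xᵀ * X + diagonal fun c => 1 / s c) (d : η → ℝ)
    {μ : ι → ℝ} (hμ : μ = Q⁻¹ *ᵥ (Xᵀ *ᵥ d)) {v : ℝ} (hv : 0 < v) (θ : ι → ℝ) :
    (∏ c, gaussianPDF 0 (s c * v).toNNReal (θ c)) *
        ∏ h, gaussianPDF ((X *ᵥ θ) h) v.toNNReal (d h) =
      ENNReal.ofReal (regressionEvidence (Fintype.card η) (diagonal fun c => 1 / s c).det Q.det
        ((d ⬝ᵥ d - μ ⬝ᵥ (Q *ᵥ μ)) / 2) v) *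
      ENNReal.ofReal (√(v⁻¹ • Q).det * (√(2 * Real.pi))⁻¹ ^ Fintype.card ι *
          Real.exp (-((θ - μ) ⬝ᵥ (v⁻¹ • Q) *ᵥ (θ - μ)) / 2)) := by
  have hpd : Q.PosDef := hQ ▸ posDef_gram_add_diagonal hs X
  have hsv : ∀ c, 0 < s c * v := fun c => mul_pos (hs c) hv
  have hsq := regression_sum_of_squares hs X hQ d hμ θ
  simp only [gaussianPDF]
  rw [← ENNReal.ofReal_prod_of_nonneg fun i _ => gaussianPDFReal_nonneg _ _ _,
    ← ENNReal.ofReal_prod_of_nonneg fun i _ => gaussianPDFReal_nonneg _ _ _,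
    ← ENNReal.ofReal_mul (Finset.prod_nonneg fun i _ => gaussianPDFReal_nonneg _ _ _),
    ← ENNReal.ofReal_mul (by unfold regressionEvidence; positivity)]
  congr 1
  simp only [gaussianPDFReal, Real.coe_toNNReal v hv.le, Real.coe_toNNReal _ (hsv _).le,
    regressionEvidence]
  have h1 : ∏ c, (√(2 * Real.pi * (s c * v)))⁻¹ =
      (√(2 * Real.pi))⁻¹ ^ Fintype.card ι * √v⁻¹ ^ Fintype.card ι *
        √(diagonal fun c => 1 / s c).det := by
    rw [det_diagonal, Real.sqrt_prod _ fun c _ => (one_div_pos.mpr (hs c)).le, ← Finset.card_univ,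
      ← Finset.prod_const, ← Finset.prod_const, ← Finset.prod_mul_distrib,
      ← Finset.prod_mul_distrib]
    refine Finset.prod_congr rfl fun c _ => ?_
    rw [Real.sqrt_mul (by positivity), Real.sqrt_mul (hs c).le, one_div, Real.sqrt_inv,
      Real.sqrt_inv, mul_inv, mul_inv]
    ring
  have h2 : √(v⁻¹ • Q).det = √v⁻¹ ^ Fintype.card ι * √Q.det := by
    have h : v⁻¹ ^ Fintype.card ι = (√v⁻¹ ^ Fintype.card ι) ^ 2 := by
      rw [← pow_mul, mul_comm, pow_mul, Real.sq_sqrt (inv_pos.mpr hv).le]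
    rw [det_smul, Real.sqrt_mul (by positivity), h, Real.sqrt_sq (by positivity)]
  have h3 : Real.exp (∑ c, -(θ c - 0) ^ 2 / (2 * (s c * v))) *
      Real.exp (∑ h, -(d h - (X *ᵥ θ) h) ^ 2 / (2 * v)) =
      Real.exp (-((d ⬝ᵥ d - μ ⬝ᵥ (Q *ᵥ μ)) / 2) / v) *
        Real.exp (-((θ - μ) ⬝ᵥ (v⁻¹ • Q) *ᵥ (θ - μ)) / 2) := by
    rw [← Real.exp_add, ← Real.exp_add]
    congr 1
    have e1 : ∑ c, -(θ c - 0) ^ 2 / (2 * (s c * v)) = -(∑ c, θ c ^ 2 / s c) / (2 * v) := by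
      rw [← Finset.sum_neg_distrib, Finset.sum_div]
      refine Finset.sum_congr rfl fun c _ => ?_
      have := (hs c).ne'
      field_simp
      ring
    have e2 : ∑ h, -(d h - (X *ᵥ θ) h) ^ 2 / (2 * v) =
        -(∑ h, (d h - (X *ᵥ θ) h) ^ 2) / (2 * v) := by
      rw [← Finset.sum_neg_distrib, Finset.sum_div]
    rw [e1, e2, ← add_div, ← neg_add, hsq, smul_mulVec, dotProduct_smul, smul_eq_mul]
    field_simp
    ring
  have hQ0 : √Q.det ≠ 0 := (Real.sqrt_pos.mpr hpd.det_pos).ne'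
  rw [Finset.prod_mul_distrib, Finset.prod_mul_distrib, h1, ← Real.exp_sum, ← Real.exp_sum, h2,
    Finset.prod_const, Finset.card_univ]
  calc _ = (√(2 * Real.pi))⁻¹ ^ Fintype.card ι * √v⁻¹ ^ Fintype.card ι *
        √(diagonal fun c => 1 / s c).det * (√(2 * Real.pi * v))⁻¹ ^ Fintype.card η *
        (Real.exp (∑ c, -(θ c - 0) ^ 2 / (2 * (s c * v))) *
      Real.exp (∑ h, -(d h - (X *ᵥ θ) h) ^ 2 / (2 * v))) := by ring
    _ = _ := by
      rw [h3]
      field_simp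

/-- Bayes' formula for the coefficients of a normal linear regression, the error variance being
known. -/
theorem pi_gaussianReal_withDensity_likelihood {s : ι → ℝ} (hs : ∀ c, 0 < s c)
    (X : Matrix η ι ℝ) {Q : Matrix ι ι ℝ} (hQ : Q = Xᵀ * X + diagonal fun c => 1 / s c)
    (d : η → ℝ) {μ : ι → ℝ} (hμ : μ = Q⁻¹ *ᵥ (Xᵀ *ᵥ d)) {v : ℝ} (hv : 0 < v) :
    ((Measure.pi fun c => gaussianReal 0 (s c * v).toNNReal).withDensity
        fun θ => ∏ h, gaussianPDF ((X *ᵥ θ) h) v.toNNReal (d h)).map (WithLp.toLp 2) =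
      ENNReal.ofReal (regressionEvidence (Fintype.card η) (diagonal fun c => 1 / s c).det Q.det
        ((d ⬝ᵥ d - μ ⬝ᵥ (Q *ᵥ μ)) / 2) v) •
      multivariateGaussian (WithLp.toLp 2 μ) (v • Q⁻¹) := by
  have hpd : Q.PosDef := hQ ▸ posDef_gram_add_diagonal hs X
  -- The density formula is stated through the precision matrix, here `v⁻¹ • Q`.
  have hinv : v • Q⁻¹ = (v⁻¹ • Q)⁻¹ := by
    have : Invertible v⁻¹ := invertibleOfNonzero (inv_ne_zero hv.ne')
    rw [Matrix.inv_smul Q v⁻¹ hpd.det_pos.ne'.isUnit, invOf_eq_inv, inv_inv]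
  have hlik : Measurable fun θ : ι → ℝ => ∏ h, gaussianPDF ((X *ᵥ θ) h) v.toNNReal (d h) := by
    refine Finset.measurable_prod _ fun h _ => ?_
    have : Continuous fun θ : ι → ℝ => (X *ᵥ θ) h :=
      (continuous_apply h).comp (Continuous.matrix_mulVec continuous_const continuous_id)
    have := this.measurable
    unfold gaussianPDF gaussianPDFReal
    fun_prop
  have hpr : Measurable fun θ : ι → ℝ => ∏ c, gaussianPDF 0 (s c * v).toNNReal (θ c) :=
    Finset.measurable_prod _ fun c _ => (measurable_gaussianPDF _ _).comp (measurable_pi_apply c)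
  rw [hinv, multivariateGaussian_inv_eq_map_withDensity (hpd.smul (inv_pos.mpr hv)) μ,
    pi_withDensity_eq (fun _ => volume) _ (fun c => measurable_gaussianPDF 0 (s c * v).toNNReal)
      (fun c => gaussianReal_of_var_ne_zero 0
        (by simpa using mul_pos (hs c) hv)), ← volume_pi, ← withDensity_mul _ hpr hlik,
    ← Measure.map_smul, ← withDensity_smul']
  · congr 2
    ext θ
    exact prior_mul_likelihood_density hs X hQ d hμ hv θ
  · exact ENNReal.ofReal_ne_top

end Regression

/-! ### Normal distributions with a random scale -/

/-- Writing the law as that of `m + √v Z`, with `Z` of a law free of `v`, exhibits measurable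
dependence on `v`; this is what makes it a kernel. -/
theorem multivariateGaussian_smul_eq_map {ι : Type*} [Fintype ι] [DecidableEq ι]
    (m : EuclideanSpace ℝ ι) {S : Matrix ι ι ℝ} (hS : S.PosSemidef) {v : ℝ} (hv : 0 ≤ v) :
    multivariateGaussian m (v • S) = (multivariateGaussian 0 S).map fun z => m + √v • z := by
  have hcomp : (fun z : EuclideanSpace ℝ ι => m + √v • z) = (fun z => m + z) ∘ (fun z => √v • z) :=
    rfl
  have : IsProbabilityMeasure ((multivariateGaussian 0 S).map fun z => m + √v • z) :=
    Measure.isProbabilityMeasure_map (by fun_prop)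
  refine Measure.ext_of_charFun ?_
  ext t
  rw [hcomp, ← Measure.map_map (by fun_prop) (by fun_prop), charFun_map_const_add,
    charFun_map_smul, charFun_multivariateGaussian hS, charFun_multivariateGaussian (hS.smul hv),
    ← Complex.exp_add, inner_zero_right, real_inner_comm]
  congr 1
  have h : t.ofLp ⬝ᵥ (v • S) *ᵥ t.ofLp = (√v • t).ofLp ⬝ᵥ S *ᵥ (√v • t).ofLp := by
    rw [WithLp.ofLp_smul, mulVec_smul, dotProduct_smul, smul_dotProduct, smul_mulVec,
      dotProduct_smul, smul_smul, Real.mul_self_sqrt hv]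
  rw [h]
  simp only [Complex.ofReal_zero, zero_mul, zero_sub]
  ring

/-- The normal distribution with mean `m` and covariance matrix `v S`, as a Markov kernel in
`v ≥ 0`. -/
noncomputable def gaussianScaleKernel {ι : Type*} [Fintype ι] [DecidableEq ι]
    (m : EuclideanSpace ℝ ι) (S : Matrix ι ι ℝ) : Kernel ℝ (EuclideanSpace ℝ ι) :=
  (Kernel.id ×ₖ Kernel.const ℝ (multivariateGaussian 0 S)).map fun p => m + √p.1 • p.2

instance instIsMarkovKernelGaussianScaleKernel {ι : Type*} [Fintype ι] [DecidableEq ι]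
    (m : EuclideanSpace ℝ ι) (S : Matrix ι ι ℝ) : IsMarkovKernel (gaussianScaleKernel m S) :=
  Kernel.IsMarkovKernel.map _ (by fun_prop)

theorem gaussianScaleKernel_apply {ι : Type*} [Fintype ι] [DecidableEq ι]
    (m : EuclideanSpace ℝ ι) {S : Matrix ι ι ℝ} (hS : S.PosSemidef) {v : ℝ} (hv : 0 ≤ v) :
    gaussianScaleKernel m S v = multivariateGaussian m (v • S) := by
  rw [multivariateGaussian_smul_eq_map m hS hv, gaussianScaleKernel,
    Kernel.map_apply _ (by fun_prop), Kernel.prod_apply, Kernel.id_apply, Kernel.const_apply,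
    Measure.dirac_prod, Measure.map_map (by fun_prop) (by fun_prop)]
  rfl

namespace NIGMG

variable {J L : ℕ} (P : NIGMG J L)

/-! ### The posterior of the coefficients at a node -/

theorem scale_pos (j : ℕ) (c : P.Coef) : 0 < P.scale j c := by
  have h := Real.rpow_pos_of_pos (zero_lt_two (α := ℝ)) (-P.α * (j : ℝ))
  cases c with
  | none => exact mul_pos h P.τ_pos
  | some c => exact mul_pos h (P.υ_pos _)

theorem act_eq_zero_or_one (x : State L) (c : P.Coef) : P.act x c = 0 ∨ P.act x c = 1 := by
  have h : ∀ i : Fin 2, ((i : ℕ) : ℝ) = 0 ∨ ((i : ℕ) : ℝ) = 1 := by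
    intro i
    fin_cases i <;> simp
  cases c with
  | none => exact h _
  | some c => exact h _

theorem posDef_Lam (j : ℕ) : (P.Lam j).PosDef := posDef_diagonal_one_div (P.scale_pos j)

theorem posDef_LamStar (j : ℕ) (x : State L) : (P.LamStar j x).PosDef :=
  posDef_gram_add_diagonal (P.scale_pos j) _

theorem Ups_nonneg (j : ℕ) (d : P.Obs → ℝ) (x : State L) : 0 ≤ P.Ups j d x :=
  regression_residual_nonneg (P.scale_pos j) (P.designSel x) rfl d rfl

theorem priorScale_pos : 0 < P.ν * P.σ₀ ^ 2 := mul_pos P.ν_pos (pow_pos P.σ₀_pos 2)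

theorem postScale_pos (j : ℕ) (d : P.Obs → ℝ) (x : State L) :
    0 < P.ν * P.σ₀ ^ 2 + P.Ups j d x :=
  add_pos_of_pos_of_nonneg P.priorScale_pos (P.Ups_nonneg j d x)

/-- If the coefficient is switched off, its column of the selected design is zero, so its row of
`Λ^* μ^* = X(s, r)' d` reads `μ^*_c / scale_c = 0`. Hence masking does not move the posterior mean.
-/
theorem act_mul_muStar (j : ℕ) (d : P.Obs → ℝ) (x : State L) (c : P.Coef) :
    P.act x c * P.muStar j d x c = P.muStar j d x c := by
  rcases P.act_eq_zero_or_one x c with h | h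
  · have hQ : P.LamStar j x *ᵥ P.muStar j d x = (P.designSel x)ᵀ *ᵥ d := by
      rw [muStar, mulVec_mulVec, mul_nonsing_inv _ (P.posDef_LamStar j x).det_pos.ne'.isUnit,
        one_mulVec]
    have hcol : ∀ h', P.designSel x h' c = 0 := fun h' => by simp [designSel, h]
    have h1 := congrFun hQ c
    rw [LamStar, add_mulVec, ← mulVec_mulVec, Pi.add_apply, Lam, mulVec_diagonal] at h1
    simp only [mulVec, dotProduct, transpose_apply, hcol, zero_mul, Finset.sum_const_zero,
      zero_add] at h1
    have := (one_div_pos.mpr (P.scale_pos j c)).ne'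
    rw [h, zero_mul]
    exact ((mul_eq_zero.mp h1).resolve_left this).symm
  · rw [h, one_mul]

/-- Hadamard masking is conjugation by a diagonal matrix, that is, the effect of the mask on a
covariance. -/
theorem maskMat_hadamard (x : State L) (A : Matrix P.Coef P.Coef ℝ) :
    P.maskMat x ⊙ A = diagonal (P.act x) * A * (diagonal (P.act x))ᵀ := by
  ext c c'
  simp only [diagonal_transpose, mul_diagonal, diagonal_mul, hadamard_apply, maskMat,
    vecMulVec_apply]
  ring

theorem posSemidef_mask_inv (j : ℕ) (x : State L) :
    (P.maskMat x ⊙ (P.LamStar j x)⁻¹).PosSemidef := by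
  rw [maskMat_hadamard, ← conjTranspose_eq_transpose_of_trivial]
  exact (P.posDef_LamStar j x).inv.posSemidef.mul_mul_conjTranspose_same _

/-- The mask moves from the coefficients to the design, leaving a regression with nondegenerate
prior. -/
theorem design_mulVec_mask (x : State L) (θ : P.Coef → ℝ) :
    P.design *ᵥ (fun c => P.act x c * θ c) = P.designSel x *ᵥ θ := by
  ext h
  simp only [mulVec, dotProduct, designSel, of_apply]
  exact Finset.sum_congr rfl fun c _ => by ring

theorem measurable_nodeLik_uncurry :
    Measurable fun p : (P.Obs → ℝ) × (ℝ × P.Theta) => P.nodeLik p.1 p.2 := by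
  unfold nodeLik
  refine Finset.measurable_prod _ fun h _ => ?_
  have : Measurable fun p : (P.Obs → ℝ) × (ℝ × P.Theta) => (P.design *ᵥ p.2.2.ofLp) h := by
    change Measurable fun p : (P.Obs → ℝ) × (ℝ × P.Theta) => ∑ c, P.design h c * p.2.2.ofLp c
    fun_prop
  unfold gaussianPDF gaussianPDFReal
  fun_prop

theorem measurable_nodeLik (d : P.Obs → ℝ) : Measurable (P.nodeLik d) := by
  have h : Measurable fun y : ℝ × P.Theta => (d, y) := measurable_prodMk_left
  have h2 := P.measurable_nodeLik_uncurry.comp h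
  simp only [Function.comp_def] at h2
  exact h2

/-- The prior of the coefficients is the image of a nondegenerate normal distribution. -/
theorem priorCoef_eq_map (j : ℕ) (x : State L) (v : ℝ) :
    P.priorCoef j x v =
      (Measure.pi fun c : P.Coef => gaussianReal 0 (P.scale j c * v).toNNReal).map
        fun θ => WithLp.toLp 2 fun c => P.act x c * θ c := by
  have h1 : ∀ c : P.Coef, gaussianReal 0 (P.act x c * P.scale j c * v).toNNReal =
      (gaussianReal 0 (P.scale j c * v).toNNReal).map (fun y => P.act x c * y) := by
    intro c
    rw [gaussianReal_map_const_mul, mul_zero]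
    congr 1
    -- The image has variance factor `act ^ 2`, which equals `act` for a value in `{0, 1}`.
    rcases P.act_eq_zero_or_one x c with h | h
    · simp [h]
    · simp [h]
  rw [priorCoef]
  simp_rw [h1]
  rw [← Measure.pi_map_pi (fun c => by fun_prop), Measure.map_map (by fun_prop) (by fun_prop)]
  rfl

/-- The factor `∏ (2π v)^{-1/2} |Λ|^{1/2} |Λ^*|^{-1/2} exp(-Υ / v)`. -/
noncomputable def evidence (j : ℕ) (d : P.Obs → ℝ) (x : State L) (v : ℝ) : ℝ :=
  regressionEvidence P.n (P.Lam j).det (P.LamStar j x).det (P.Ups j d x) v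

/-- The prior may be degenerate and have no density. Its likelihood is therefore pulled back through
the mask, Bayes' formula is applied to the nondegenerate vector, and the resulting normal law is
pushed forward again. -/
theorem priorCoef_withDensity_nodeLik (j : ℕ) (d : P.Obs → ℝ) (x : State L) {v : ℝ}
    (hv : 0 < v) :
    (P.priorCoef j x v).withDensity (fun θ => P.nodeLik d (v, θ)) =
      ENNReal.ofReal (P.evidence j d x v) •
        multivariateGaussian (WithLp.toLp 2 (P.muStar j d x))
          (v • (P.maskMat x ⊙ (P.LamStar j x)⁻¹)) := by
  have hcomp : (fun θ : P.Coef → ℝ => (WithLp.toLp 2 fun c => P.act x c * θ c : P.Theta)) =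
      (toEuclideanCLM (𝕜 := ℝ) (diagonal (P.act x))) ∘ (WithLp.toLp 2) := by
    ext θ c
    simp [mulVec_diagonal]
  have hmean : toEuclideanCLM (𝕜 := ℝ) (diagonal (P.act x)) (WithLp.toLp 2 (P.muStar j d x)) =
      WithLp.toLp 2 (P.muStar j d x) := by
    ext c
    simp [mulVec_diagonal, P.act_mul_muStar]
  have hcov : diagonal (P.act x) * (v • (P.LamStar j x)⁻¹) * (diagonal (P.act x))ᵀ =
      v • (P.maskMat x ⊙ (P.LamStar j x)⁻¹) := by
    rw [maskMat_hadamard, mul_smul_comm, smul_mul_assoc]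
  have hf : Measurable fun θ : P.Theta => P.nodeLik d (v, θ) :=
    (P.measurable_nodeLik d).comp measurable_prodMk_left
  have hg : Measurable fun θ : P.Coef → ℝ =>
      (WithLp.toLp 2 fun c => P.act x c * θ c : P.Theta) := by
    fun_prop
  rw [P.priorCoef_eq_map j x v, map_withDensity_comp _ hg hf]
  have hlik : (fun θ : P.Theta => P.nodeLik d (v, θ)) ∘
      (fun θ : P.Coef → ℝ => (WithLp.toLp 2 fun c => P.act x c * θ c : P.Theta)) =
      fun θ => ∏ h, gaussianPDF ((P.designSel x *ᵥ θ) h) v.toNNReal (d h) := by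
    ext θ
    simp only [Function.comp, nodeLik, design_mulVec_mask]
  have key := pi_gaussianReal_withDensity_likelihood (P.scale_pos j) (P.designSel x)
    (Q := P.LamStar j x) rfl d (μ := P.muStar j d x) rfl hv
  rw [hlik, hcomp, ← Measure.map_map (by fun_prop) (by fun_prop), key, Measure.map_smul,
    multivariateGaussian_map_toEuclideanCLM _
      ((P.posDef_LamStar j x).inv.posSemidef.smul hv.le), hmean, hcov]
  rfl

/-! ### The posterior at a node -/

/-- In `v` the evidence is a multiple of `v ^ (-n / 2) * exp (-Υ / v)`: it raises the shape by `n /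
2` and the scale by `Υ`, and `marg` collects the normalizing constants. -/
theorem invGammaPDF_mul_evidence (D : P.Data) (t : Node J) (x : State L) {v : ℝ} (hv : 0 < v) :
    invGammaPDF (P.ν + 1) (P.ν * P.σ₀ ^ 2) v * ENNReal.ofReal (P.evidence t.1 (D t) x v) =
      ENNReal.ofReal (P.marg D t x) *
        invGammaPDF (P.ν + 1 + (P.n : ℝ) / 2) (P.ν * P.σ₀ ^ 2 + P.Ups t.1 (D t) x) v := by
  have hb := P.priorScale_pos
  have hU := P.postScale_pos t.1 (D t) x
  have hν := P.ν_pos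
  have hG : 0 < Real.Gamma (P.ν + 1) := Real.Gamma_pos_of_pos (by linarith)
  have hG' : 0 < Real.Gamma (P.ν + 1 + (P.n : ℝ) / 2) := Real.Gamma_pos_of_pos (by positivity)
  have hm : 0 ≤ P.marg D t x := by
    have : 0 < Real.Gamma (P.ν + (P.n : ℝ) / 2 + 1) := Real.Gamma_pos_of_pos (by positivity)
    unfold marg
    positivity
  simp only [invGammaPDF, hv, if_true]
  rw [← ENNReal.ofReal_mul (by positivity), ← ENNReal.ofReal_mul hm]
  congr 1
  unfold evidence regressionEvidence marg
  set b := P.ν * P.σ₀ ^ 2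
  set U := P.Ups t.1 (D t) x
  have e1 : (√(2 * Real.pi * v))⁻¹ ^ P.n =
      ((2 * Real.pi) ^ ((P.n : ℝ) / 2))⁻¹ * v ^ (-((P.n : ℝ) / 2)) := by
    rw [inv_pow, Real.sqrt_eq_rpow, ← Real.rpow_natCast, ← Real.rpow_mul (by positivity),
      Real.mul_rpow (by positivity) hv.le, mul_inv, Real.rpow_neg hv.le,
      one_div_mul_eq_div]
  have e2 : v ^ (-(P.ν + 1 + (P.n : ℝ) / 2) - 1) =
      v ^ (-(P.ν + 1) - 1) * v ^ (-((P.n : ℝ) / 2)) := by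
    rw [← Real.rpow_add hv]
    congr 1
    ring
  have e3 : Real.exp (-(b + U) / v) = Real.exp (-b / v) * Real.exp (-U / v) := by
    rw [← Real.exp_add]
    congr 1
    ring
  have e4 : (b + U) ^ (-P.ν - (P.n : ℝ) / 2 - 1) * (b + U) ^ (P.ν + 1 + (P.n : ℝ) / 2) = 1 := by
    rw [← Real.rpow_add hU]
    convert Real.rpow_zero _ using 2
    ring
  have e5 : P.ν + (P.n : ℝ) / 2 + 1 = P.ν + 1 + (P.n : ℝ) / 2 := by ring
  rw [e1, e2, e3, e5]
  set Z := (b + U) ^ (-P.ν - (P.n : ℝ) / 2 - 1)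
  set W := (b + U) ^ (P.ν + 1 + (P.n : ℝ) / 2)
  set G' := Real.Gamma (P.ν + 1 + (P.n : ℝ) / 2)
  set R := √(P.Lam t.1).det / √(P.LamStar t.1 x).det
  have hpi : 0 < (2 * Real.pi) ^ ((P.n : ℝ) / 2) := by positivity
  field_simp
  -- The power of `b + U` in `marg` is the reciprocal of the one normalizing the new density.
  linear_combination (-R) * e4

theorem marg_pos (D : P.Data) (t : Node J) (x : State L) : 0 < P.marg D t x := by
  have hb := P.priorScale_pos
  have hU := P.postScale_pos t.1 (D t) x
  have hν := P.ν_pos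
  have hG : 0 < Real.Gamma (P.ν + 1) := Real.Gamma_pos_of_pos (by linarith)
  have hG' : 0 < Real.Gamma (P.ν + (P.n : ℝ) / 2 + 1) := Real.Gamma_pos_of_pos (by positivity)
  have h1 := Real.sqrt_pos.mpr (P.posDef_Lam t.1).det_pos
  have h2 := Real.sqrt_pos.mpr (P.posDef_LamStar t.1 x).det_pos
  unfold marg
  positivity

instance instIsProbabilityMeasurePostVar (D : P.Data) (t : Node J) (x : State L) :
    IsProbabilityMeasure (P.postVar D t x) :=
  isProbabilityMeasure_invGamma (by have := P.ν_pos; positivity) (P.postScale_pos _ _ _)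

/-- The law of the coefficients given the variance and the state of a node, as a Markov kernel. -/
noncomputable def postCoefKernel (D : P.Data) (t : Node J) (x : State L) : Kernel ℝ P.Theta :=
  gaussianScaleKernel (WithLp.toLp 2 (P.muStar t.1 (D t) x))
    (P.maskMat x ⊙ (P.LamStar t.1 x)⁻¹)

instance instIsMarkovKernelPostCoefKernel (D : P.Data) (t : Node J) (x : State L) :
    IsMarkovKernel (P.postCoefKernel D t x) := by
  unfold postCoefKernel
  infer_instance

theorem postCoefKernel_apply (D : P.Data) (t : Node J) (x : State L) {v : ℝ} (hv : 0 < v) :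
    P.postCoefKernel D t x v = P.postCoef D t x v :=
  gaussianScaleKernel_apply _ (P.posSemidef_mask_inv t.1 x) hv.le

/-- The defining `bind` uses a bare function of `v`, with no measurability established. It agrees
with a kernel for `v > 0`, hence almost everywhere, which is enough. -/
theorem postNode_eq_compProd (D : P.Data) (t : Node J) (x : State L) :
    P.postNode D t x = P.postVar D t x ⊗ₘ P.postCoefKernel D t x := by
  have h : (fun v => (P.postCoef D t x v).map (Prod.mk v)) =ᵐ[P.postVar D t x]
      fun v => (Kernel.id ×ₖ P.postCoefKernel D t x) v := by
    filter_upwards [ae_pos_invGamma _ _] with v hv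
    rw [Kernel.prod_apply, Kernel.id_apply, Measure.dirac_prod, P.postCoefKernel_apply D t x hv]
  rw [postNode, Measure.bind_congr_right h, Measure.compProd_eq_comp_prod]

instance instIsProbabilityMeasurePostNode (D : P.Data) (t : Node J) (x : State L) :
    IsProbabilityMeasure (P.postNode D t x) := by
  rw [postNode_eq_compProd]
  infer_instance

theorem postNode_map_fst (D : P.Data) (t : Node J) (x : State L) :
    (P.postNode D t x).map Prod.fst = P.postVar D t x := by
  rw [postNode_eq_compProd]
  exact Measure.fst_compProd _ _

/-- Bayes' formula at a node. -/
theorem priorNode_withDensity_nodeLik (D : P.Data) (t : Node J) (x : State L) :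
    (P.priorNode t x).withDensity (P.nodeLik (D t)) =
      ENNReal.ofReal (P.marg D t x) • P.postNode D t x := by
  ext s hs
  have hmeas : Measurable (s.indicator (P.nodeLik (D t))) := (P.measurable_nodeLik _).indicator hs
  have hpdf : ∀ a b : ℝ, ∀ᵐ v : ℝ, invGammaPDF a b v < ∞ := fun a b =>
    Filter.Eventually.of_forall fun v => by
      unfold invGammaPDF
      split_ifs <;> simp
  rw [withDensity_apply _ hs, Measure.smul_apply, postNode_eq_compProd,
    Measure.compProd_apply hs, ← lintegral_indicator hs, priorNode,
    Measure.lintegral_bind (P.measurable_priorCoef_map _ x).aemeasurable hmeas.aemeasurable,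
    invGamma, lintegral_withDensity_eq_lintegral_mul_non_measurable _ (measurable_invGammaPDF _ _)
      (hpdf _ _), postVar, invGamma, lintegral_withDensity_eq_lintegral_mul_non_measurable _
      (measurable_invGammaPDF _ _) (hpdf _ _), smul_eq_mul,
    ← lintegral_const_mul' _ _ ENNReal.ofReal_ne_top]
  refine lintegral_congr fun v => ?_
  simp only [Pi.mul_apply]
  -- The two integrands agree for each `v`: by conjugacy if `v > 0`, and otherwise because both
  -- inverse-Gamma densities vanish.
  by_cases hv : 0 < v
  · have hsv : MeasurableSet (Prod.mk v ⁻¹' s) := measurable_prodMk_left hs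
    have h1 : ∫⁻ y, s.indicator (P.nodeLik (D t)) y ∂(P.priorCoef t.1 x v).map (Prod.mk v) =
        ENNReal.ofReal (P.evidence t.1 (D t) x v) *
          P.postCoefKernel D t x v (Prod.mk v ⁻¹' s) := by
      rw [lintegral_map hmeas measurable_prodMk_left, P.postCoefKernel_apply D t x hv, postCoef,
        ← smul_eq_mul, ← Measure.smul_apply, ← P.priorCoef_withDensity_nodeLik _ _ _ hv,
        withDensity_apply _ hsv, ← lintegral_indicator hsv]
      rfl
    rw [h1, ← mul_assoc, P.invGammaPDF_mul_evidence D t x hv, mul_assoc]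
  · simp [invGammaPDF, hv]

theorem lintegral_nodeLik_priorNode (D : P.Data) (t : Node J) (x : State L) :
    ∫⁻ y, P.nodeLik (D t) y ∂(P.priorNode t x) = ENNReal.ofReal (P.marg D t x) := by
  have h := congrArg (fun μ => μ Set.univ) (P.priorNode_withDensity_nodeLik D t x)
  simpa using h

end NIGMG

/-! ### Summation over configurations -/

section Configurations

variable {V A : Type*} [Fintype V] [DecidableEq V] [Fintype A]

/-- Exchanging the value at `t` with the spare value `a` is an involution of the pairs `(c, a)`. -/
theorem sum_sum_update (t : V) (f : (V → A) → ℝ) :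
    ∑ c : V → A, ∑ a, f (Function.update c t a) = Fintype.card A * ∑ c, f c := by
  let e : (V → A) × A → (V → A) × A := fun p => (Function.update p.1 t p.2, p.1 t)
  have he : Function.Involutive e := fun p => by simp [e]
  calc ∑ c : V → A, ∑ a, f (Function.update c t a)
      = ∑ p : (V → A) × A, f (e p).1 := by rw [Fintype.sum_prod_type]
    _ = ∑ p : (V → A) × A, f p.1 := Equiv.sum_comp he.toPerm fun p => f p.1
    _ = Fintype.card A * ∑ c, f c := by
      rw [Fintype.sum_prod_type]
      simp [Finset.mul_sum]

/-- Summing out a stochastic factor at a coordinate on which nothing else depends. -/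
theorem card_mul_sum_mul_of_invariant (t : V) {K H : (V → A) → ℝ}
    (hK : ∀ c, ∑ a, K (Function.update c t a) = 1)
    (hH : ∀ c a, H (Function.update c t a) = H c) :
    Fintype.card A * ∑ c, K c * H c = ∑ c, H c := by
  -- The factor `Fintype.card A` pays for resampling coordinate `t` while still summing over full
  -- configurations.
  rw [← sum_sum_update t]
  refine Finset.sum_congr rfl fun c _ => ?_
  simp_rw [hH, ← Finset.sum_mul, hK, one_mul]

/-- Summing out stochastic factors from the last level upwards. -/
theorem card_pow_mul_sum_prod_mul_of_invariant (level : V → ℕ) (K : V → (V → A) → ℝ)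
    (G : (V → A) → ℝ) (S : Finset V)
    (hK : ∀ t ∈ S, ∀ c, ∑ a, K t (Function.update c t a) = 1)
    (hKK : ∀ t ∈ S, ∀ t' ∈ S, t' ≠ t → level t ≤ level t' →
      ∀ c a, K t (Function.update c t' a) = K t c)
    (hG : ∀ t ∈ S, ∀ c a, G (Function.update c t a) = G c) :
    (Fintype.card A : ℝ) ^ S.card * ∑ c, (∏ t ∈ S, K t c) * G c = ∑ c, G c := by
  -- A node of greatest level is removed: no other factor in the product depends on its state.
  induction S using Finset.induction_on_max_value level with
  | empty => simp
  | insert b S hb hmax ih =>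
    have ih := ih (fun t ht => hK t (Finset.mem_insert_of_mem ht))
      (fun t ht t' ht' => hKK t (Finset.mem_insert_of_mem ht) t' (Finset.mem_insert_of_mem ht'))
      (fun t ht => hG t (Finset.mem_insert_of_mem ht))
    have h := card_mul_sum_mul_of_invariant b (K := K b) (H := fun c => (∏ t ∈ S, K t c) * G c)
      (hK b (Finset.mem_insert_self b S)) (fun c a => by
        simp only [hG b (Finset.mem_insert_self b S)]
        congr 1
        refine Finset.prod_congr rfl fun t ht => ?_
        exact hKK t (Finset.mem_insert_of_mem ht) b (Finset.mem_insert_self b S)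
          (fun hbt => hb (hbt ▸ ht)) (hmax t ht) c a)
    rw [← ih, ← h, Finset.card_insert_of_notMem hb, pow_succ, mul_assoc]
    congr 2
    refine Finset.sum_congr rfl fun c _ => ?_
    rw [Finset.prod_insert hb, mul_assoc]

end Configurations

/-! ### Nodes -/

namespace Node

variable {J : ℕ}

theorem ext_val {t t' : Node J} (h1 : (t.1 : ℕ) = t'.1) (h2 : (t.2 : ℕ) = t'.2) : t = t' := by
  obtain ⟨⟨j, hj⟩, ⟨k, hk⟩⟩ := t
  obtain ⟨⟨j', hj'⟩, ⟨k', hk'⟩⟩ := t'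
  simp only at h1 h2
  subst h1 h2
  rfl

theorem eq_root_of_level_eq_zero {t : Node J} (h : (t.1 : ℕ) = 0) : t = root J := by
  refine ext_val h ?_
  have h2 := t.2.2
  have h3 : (t.2 : ℕ) < 1 := by simpa [h] using h2
  change (t.2 : ℕ) = 0
  omega

theorem parent_ne {t : Node J} (h : (t.1 : ℕ) ≠ 0) : t.parent ≠ t := by
  intro heq
  have : (t.parent.1 : ℕ) = t.1 := by rw [heq]
  change (t.1 : ℕ) - 1 = t.1 at this
  omega

theorem parent_child (t : Node J) (h : (t.1 : ℕ) < J) (b : Fin 2) : (t.child h b).parent = t := by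
  refine ext_val ?_ ?_
  · change (t.1 : ℕ) + 1 - 1 = t.1
    omega
  · change (2 * (t.2 : ℕ) + (b : ℕ)) / 2 = t.2
    omega

theorem child_level_ne_zero (t : Node J) (h : (t.1 : ℕ) < J) (b : Fin 2) :
    ((t.child h b).1 : ℕ) ≠ 0 := Nat.succ_ne_zero _

theorem eq_child_of_parent_eq {t p : Node J} (ht : (t.1 : ℕ) ≠ 0) (hp : t.parent = p)
    (h : (p.1 : ℕ) < J) : t = p.child h 0 ∨ t = p.child h 1 := by
  subst hp
  have h1 : (t.1 : ℕ) = (t.1 : ℕ) - 1 + 1 := by omega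
  rcases Nat.mod_two_eq_zero_or_one (t.2 : ℕ) with h2 | h2
  · left
    refine ext_val h1 ?_
    change (t.2 : ℕ) = 2 * ((t.2 : ℕ) / 2) + 0
    omega
  · right
    refine ext_val h1 ?_
    change (t.2 : ℕ) = 2 * ((t.2 : ℕ) / 2) + 1
    omega

theorem child_zero_ne_child_one (p : Node J) (h : (p.1 : ℕ) < J) :
    p.child h 0 ≠ p.child h 1 := by
  intro heq
  have : ((p.child h 0).2 : ℕ) = (p.child h 1).2 := by rw [heq]
  change 2 * (p.2 : ℕ) + 0 = 2 * (p.2 : ℕ) + 1 at this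
  omega

/-- A product over the nodes other than the root, arranged by parents. -/
theorem prod_level_ne_zero (f : Node J → ℝ) :
    ∏ t with (t.1 : ℕ) ≠ 0, f t =
      ∏ p : Node J, if h : (p.1 : ℕ) < J then f (p.child h 0) * f (p.child h 1) else 1 := by
  rw [← Finset.prod_fiberwise _ Node.parent]
  refine Finset.prod_congr rfl fun p _ => ?_
  split_ifs with h
  · rw [← Finset.prod_pair (child_zero_ne_child_one p h)]
    refine Finset.prod_congr ?_ fun _ _ => rfl
    ext t
    simp only [Finset.mem_filter, Finset.mem_univ, true_and, Finset.mem_insert,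
      Finset.mem_singleton]
    constructor
    · rintro ⟨ht, hp⟩
      exact eq_child_of_parent_eq ht hp h
    · rintro (rfl | rfl)
      · exact ⟨child_level_ne_zero p h 0, parent_child p h 0⟩
      · exact ⟨child_level_ne_zero p h 1, parent_child p h 1⟩
  · refine Finset.prod_eq_one fun t ht => absurd ?_ h
    simp only [Finset.mem_filter, Finset.mem_univ, true_and] at ht
    rw [← ht.2]
    change (t.1 : ℕ) - 1 < J
    have := t.1.2
    omega

end Node

/-! ### Marginals of Markov trees -/

section MarkovTree

variable {J : ℕ} {A : Type} [Fintype A]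

/-- The factor of a node in the probability of a configuration of a Markov tree. -/
def markovFactor (init : A → ℝ) (trans : Node J → A → A → ℝ) (t : Node J) (c : Node J → A) : ℝ :=
  if (t.1 : ℕ) = 0 then init (c t) else trans t (c t.parent) (c t)

theorem IsStochastic.nonempty {init : A → ℝ} {trans : Node J → A → A → ℝ}
    (h : IsStochastic init trans) : Nonempty A := by
  by_contra hA
  rw [not_nonempty_iff] at hA
  simpa using h.2.1

theorem IsStochastic.mass_nonneg {init : A → ℝ} {trans : Node J → A → A → ℝ}
    (h : IsStochastic init trans) (c : Node J → A) : 0 ≤ markovTreeMass init trans c := by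
  refine Finset.prod_nonneg fun t _ => ?_
  split_ifs with ht
  · exact h.1 _
  · exact (h.2.2 t ht _).1 _

/-- The levels from `l` on may be summed out. -/
theorem IsStochastic.card_pow_mul_sum_mass_mul {init : A → ℝ} {trans : Node J → A → A → ℝ}
    (h : IsStochastic init trans) (l : ℕ) (F : (Node J → A) → ℝ)
    (hF : ∀ t : Node J, l ≤ (t.1 : ℕ) → ∀ c a, F (Function.update c t a) = F c) :
    (Fintype.card A : ℝ) ^ (Finset.univ.filter fun t : Node J => l ≤ (t.1 : ℕ)).card *
        ∑ c, markovTreeMass init trans c * F c =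
      ∑ c, (∏ t : Node J with ¬ l ≤ (t.1 : ℕ), markovFactor init trans t c) * F c := by
  -- A factor involves its own node and, away from the root, the parent, which lies strictly above;
  -- other nodes at the same or a deeper level are irrelevant.
  have hinv : ∀ t t' : Node J, t' ≠ t → (t.1 : ℕ) ≤ t'.1 → ∀ c a,
      markovFactor init trans t (Function.update c t' a) = markovFactor init trans t c := by
    intro t t' hne hle c a
    have h1 : Function.update c t' a t = c t := Function.update_of_ne hne.symm _ _
    unfold markovFactor
    rw [h1]
    split_ifs with ht
    · rfl
    · have h2 : t.parent ≠ t' := by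
        intro heq
        have : (t.parent.1 : ℕ) = t'.1 := by rw [heq]
        change (t.1 : ℕ) - 1 = t'.1 at this
        omega
      rw [Function.update_of_ne h2]
  have key := card_pow_mul_sum_prod_mul_of_invariant (fun t : Node J => (t.1 : ℕ))
    (markovFactor init trans)
    (fun c => (∏ t : Node J with ¬ l ≤ (t.1 : ℕ), markovFactor init trans t c) * F c)
    (Finset.univ.filter fun t : Node J => l ≤ (t.1 : ℕ)) ?_ ?_ ?_
  · rw [← key]
    congr 1
    refine Finset.sum_congr rfl fun c _ => ?_
    rw [← mul_assoc, Finset.prod_filter_mul_prod_filter_not]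
    rfl
  · intro t _ c
    unfold markovFactor
    split_ifs with ht
    · simpa using h.2.1
    · simp only [Function.update_self, Function.update_of_ne (Node.parent_ne ht)]
      exact (h.2.2 t ht _).2
  · intro t _ t' _ hne hle c a
    exact hinv t t' hne hle c a
  · intro t' ht' c a
    simp only [Finset.mem_filter, Finset.mem_univ, true_and] at ht'
    simp only [hF t' ht']
    congr 1
    refine Finset.prod_congr rfl fun t ht => ?_
    simp only [Finset.mem_filter, Finset.mem_univ, true_and, not_le] at ht
    refine hinv t t' ?_ (by omega) c a
    rintro rfl
    omega

theorem IsStochastic.sum_mass {init : A → ℝ} {trans : Node J → A → A → ℝ}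
    (h : IsStochastic init trans) : ∑ c, markovTreeMass init trans c = 1 := by
  have := h.nonempty
  have key := h.card_pow_mul_sum_mass_mul 0 (fun _ => 1) (fun _ _ _ _ => rfl)
  simp only [zero_le, not_true_eq_false, Finset.filter_true, Finset.filter_false,
    Finset.prod_empty, mul_one, Finset.sum_const, Finset.card_univ, nsmul_eq_mul] at key
  have hA : (Fintype.card A : ℝ) ^ Fintype.card (Node J) ≠ 0 :=
    pow_ne_zero _ (Nat.cast_ne_zero.mpr Fintype.card_ne_zero)
  rw [Fintype.card_fun, Nat.cast_pow] at key
  exact mul_left_cancel₀ hA (key.trans (mul_one _).symm)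

variable [DecidableEq A]

/-- Replacing the initial vector by the point mass at `x` gives another Markov tree, of total mass
one; on the event its masses differ from the original ones by the factor `init x`. -/
theorem IsStochastic.sum_mass_root {init : A → ℝ} {trans : Node J → A → A → ℝ}
    (h : IsStochastic init trans) (x : A) :
    ∑ c, (if c (Node.root J) = x then markovTreeMass init trans c else 0) = init x := by
  have h' : IsStochastic (fun a => if a = x then (1 : ℝ) else 0) trans :=
    ⟨fun a => by dsimp only; split_ifs <;> norm_num, by simp, h.2.2⟩
  rw [← mul_one (init x), ← h'.sum_mass, Finset.mul_sum]
  refine Finset.sum_congr rfl fun c _ => ?_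
  have hroot : ((Node.root J).1 : ℕ) = 0 := rfl
  unfold markovTreeMass
  rw [← Finset.mul_prod_erase _ _ (Finset.mem_univ (Node.root J)),
    ← Finset.mul_prod_erase _ _ (Finset.mem_univ (Node.root J)), if_pos hroot, if_pos hroot]
  have hrest : ∀ i : A → ℝ, ∏ t ∈ Finset.univ.erase (Node.root J),
      (if (t.1 : ℕ) = 0 then i (c t) else trans t (c t.parent) (c t)) =
      ∏ t ∈ Finset.univ.erase (Node.root J), trans t (c t.parent) (c t) := by
    intro i
    refine Finset.prod_congr rfl fun t ht => if_neg fun h0 => ?_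
    exact (Finset.mem_erase.mp ht).1 (Node.eq_root_of_level_eq_zero h0)
  rw [hrest, hrest fun a => if a = x then (1 : ℝ) else 0]
  split_ifs with hc
  · simp [hc]
  · simp [hc]

/-- The transition into `t` is replaced by the deterministic jump to `x'`. This keeps the tree
stochastic and does not change the law of the parent, while the mass of each configuration in the
event is `trans t x x'` times its modified mass. -/
theorem IsStochastic.sum_mass_transition {init : A → ℝ} {trans : Node J → A → A → ℝ}
    (h : IsStochastic init trans) {t : Node J} (ht : (t.1 : ℕ) ≠ 0) (x x' : A) :
    ∑ c, (if c t.parent = x ∧ c t = x' then markovTreeMass init trans c else 0) =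
      trans t x x' * ∑ c, (if c t.parent = x then markovTreeMass init trans c else 0) := by
  have hne := h.nonempty
  let trans' : Node J → A → A → ℝ :=
    fun q => if q = t then fun _ a => if a = x' then 1 else 0 else trans q
  have h' : IsStochastic init trans' := by
    refine ⟨h.1, h.2.1, fun q hq a => ?_⟩
    by_cases hqt : q = t
    · simp only [trans', hqt, if_true]
      exact ⟨fun a => by split_ifs <;> norm_num, by simp⟩
    · simp only [trans', hqt, if_false]
      exact h.2.2 q hq a
  let F : (Node J → A) → ℝ := fun c => if c t.parent = x then 1 else 0
  have hF : ∀ q : Node J, (t.1 : ℕ) ≤ (q.1 : ℕ) → ∀ c a, F (Function.update c q a) = F c := by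
    intro q hq c a
    have : t.parent ≠ q := by
      intro heq
      have : (t.parent.1 : ℕ) = q.1 := by rw [heq]
      change (t.1 : ℕ) - 1 = q.1 at this
      omega
    simp only [F, Function.update_of_ne this]
  -- Once the levels from that of `t` on are summed out, only factors common to both trees remain.
  have hsame : ∑ c, markovTreeMass init trans c * F c = ∑ c, markovTreeMass init trans' c * F c := by
    have hA : (Fintype.card A : ℝ) ^
        (Finset.univ.filter fun q : Node J => (t.1 : ℕ) ≤ (q.1 : ℕ)).card ≠ 0 :=
      pow_ne_zero _ (Nat.cast_ne_zero.mpr Fintype.card_ne_zero)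
    refine mul_left_cancel₀ hA ?_
    rw [h.card_pow_mul_sum_mass_mul _ F hF, h'.card_pow_mul_sum_mass_mul _ F hF]
    refine Finset.sum_congr rfl fun c _ => ?_
    congr 1
    refine Finset.prod_congr rfl fun q hq => ?_
    have hqt : q ≠ t := by
      rintro rfl
      simp at hq
    simp only [markovFactor, trans', hqt, if_false]
  have hite : ∀ c, (if c t.parent = x then markovTreeMass init trans c else 0) =
      markovTreeMass init trans c * F c := fun c => by simp [F]
  simp_rw [hite]
  rw [hsame, Finset.mul_sum]
  refine Finset.sum_congr rfl fun c _ => ?_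
  unfold markovTreeMass
  rw [← Finset.mul_prod_erase _ _ (Finset.mem_univ t),
    ← Finset.mul_prod_erase _ _ (Finset.mem_univ t), if_neg ht, if_neg ht]
  have hrest : ∏ q ∈ Finset.univ.erase t,
      (if (q.1 : ℕ) = 0 then init (c q) else trans' q (c q.parent) (c q)) =
      ∏ q ∈ Finset.univ.erase t,
        (if (q.1 : ℕ) = 0 then init (c q) else trans q (c q.parent) (c q)) := by
    refine Finset.prod_congr rfl fun q hq => ?_
    simp only [trans', (Finset.mem_erase.mp hq).1, if_false]
  rw [hrest]
  by_cases h1 : c t.parent = x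
  · by_cases h2 : c t = x'
    · simp [h1, h2, F, trans']
    · simp [h2, trans']
  · simp [h1, F]

end MarkovTree

namespace NIGMG

variable {J L : ℕ} (P : NIGMG J L)

/-! ### The pyramid recursion -/

theorem isStochastic_initPr_transPr : IsStochastic P.initPr P.transPr := by
  have hsum : ∀ (p : Fin 2 → ℝ) (q : Fin L → Fin 2 → ℝ), ∑ s, p s = 1 → (∀ l, ∑ r, q l r = 1) →
      ∑ x : State L, p x.1 * ∏ l, q l (x.2 l) = 1 := by
    intro p q hp hq
    rw [Fintype.sum_prod_type]
    simp_rw [← Finset.mul_sum]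
    rw [← Finset.sum_mul, hp, one_mul, ← Fintype.piFinset_univ, ← Finset.prod_univ_sum]
    exact Finset.prod_eq_one fun l _ => hq l
  refine ⟨fun x => ?_, ?_, fun t ht x => ⟨fun x' => ?_, ?_⟩⟩
  · exact mul_nonneg (P.ρ_stochastic.1 _) (Finset.prod_nonneg fun l _ => P.κ_stochastic.1 _)
  · exact hsum P.ρ₀ (fun _ => P.κ₀) P.ρ_stochastic.2.1 fun _ => P.κ_stochastic.2.1
  · exact mul_nonneg ((P.ρ_stochastic.2.2 t ht _).1 _)
      (Finset.prod_nonneg fun l _ => (P.κ_stochastic.2.2 t ht _).1 _)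
  · exact hsum (P.ρ t x.1) (fun l => P.κ t (x.2 l)) (P.ρ_stochastic.2.2 t ht _).2
      fun l => (P.κ_stochastic.2.2 t ht _).2

/-- Exchanging the products over trees and over nodes merges the independent trees into one on the
product state space. -/
theorem priorStates_eq (c : Node J → State L) :
    P.priorStates c = markovTreeMass P.initPr P.transPr c := by
  unfold priorStates markovTreeMass
  rw [Finset.prod_comm, ← Finset.prod_mul_distrib]
  refine Finset.prod_congr rfl fun t _ => ?_
  split_ifs <;> rfl

variable (D : P.Data)

theorem phi_of_lt (t : Node J) (h : (t.1 : ℕ) < J) (x : State L) :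
    P.phi D t x = P.marg D t x * P.xi D (t.child h 0) x * P.xi D (t.child h 1) x := by
  rw [phi, dif_pos h, xi, xi, if_neg (t.child_level_ne_zero h 0),
    if_neg (t.child_level_ne_zero h 1)]

theorem phi_of_not_lt (t : Node J) (h : ¬ (t.1 : ℕ) < J) (x : State L) :
    P.phi D t x = P.marg D t x := by
  rw [phi, dif_neg h]

/-- A sum of positive numbers against probability weights is positive, since some weight is nonzero
even though others may vanish. -/
theorem xi_pos_of_phi_pos {t : Node J} (h : ∀ x, 0 < P.phi D t x) (x : State L) :
    0 < P.xi D t x := by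
  have hpos : ∀ p : State L → ℝ, (∀ a, 0 ≤ p a) → ∑ a, p a = 1 →
      0 < ∑ a, p a * P.phi D t a := by
    intro p hp hsum
    refine Finset.sum_pos' (fun a _ => mul_nonneg (hp a) (h a).le) ?_
    by_contra hcon
    push Not at hcon
    have : ∑ a, p a = 0 := Finset.sum_eq_zero fun a ha => by
      have h1 := hcon a ha
      have h2 := h a
      have h3 := hp a
      by_contra h4
      have : 0 < p a * P.phi D t a := mul_pos (lt_of_le_of_ne h3 (Ne.symm h4)) h2
      linarith
    linarith
  obtain ⟨h1, h2, h3⟩ := P.isStochastic_initPr_transPr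
  unfold xi
  split_ifs with ht
  · exact hpos _ h1 h2
  · exact hpos _ (h3 t ht x).1 (h3 t ht x).2

/-- Induction from the leaves upward. Strict positivity for all data is what makes every division by
`ξ` legitimate. -/
theorem phi_pos (t : Node J) (x : State L) : 0 < P.phi D t x := by
  induction hk : J - (t.1 : ℕ) using Nat.strong_induction_on generalizing t x with
  | _ k ih =>
    by_cases h : (t.1 : ℕ) < J
    · have hchild : ∀ b x, 0 < P.xi D (t.child h b) x := fun b x =>
        P.xi_pos_of_phi_pos D (fun x' => ih _ (by
          change J - ((t.1 : ℕ) + 1) < k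
          omega) (t.child h b) x' rfl) x
      rw [P.phi_of_lt D t h]
      exact mul_pos (mul_pos (P.marg_pos D t x) (hchild 0 x)) (hchild 1 x)
    · rw [P.phi_of_not_lt D t h]
      exact P.marg_pos D t x

theorem xi_pos (t : Node J) (x : State L) : 0 < P.xi D t x :=
  P.xi_pos_of_phi_pos D (P.phi_pos D t) x

theorem isStochastic_post : IsStochastic (P.postInit D) (P.postTrans D) := by
  obtain ⟨h1, h2, h3⟩ := P.isStochastic_initPr_transPr
  refine ⟨fun x => ?_, ?_, fun t ht x => ⟨fun x' => ?_, ?_⟩⟩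
  · exact div_nonneg (mul_nonneg (h1 x) (P.phi_pos D _ x).le) (P.xi_pos D _ _).le
  · unfold postInit
    rw [← Finset.sum_div, div_eq_one_iff_eq (P.xi_pos D _ _).ne', xi]
    exact (if_pos rfl).symm
  · exact div_nonneg (mul_nonneg ((h3 t ht x).1 x') (P.phi_pos D _ x').le) (P.xi_pos D _ _).le
  · unfold postTrans
    rw [← Finset.sum_div, div_eq_one_iff_eq (P.xi_pos D _ _).ne', xi]
    exact (if_neg ht).symm

/-- Each `φ` contributes its own `marg` and the `ξ`'s of its children, and each node other than the
root is a child exactly once. -/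
theorem prod_phi (c : Node J → State L) :
    ∏ t, P.phi D t (c t) =
      (∏ t, P.marg D t (c t)) * ∏ t : Node J with (t.1 : ℕ) ≠ 0, P.xi D t (c t.parent) := by
  rw [Node.prod_level_ne_zero, ← Finset.prod_mul_distrib]
  refine Finset.prod_congr rfl fun t _ => ?_
  split_ifs with h
  · rw [P.phi_of_lt D t h, Node.parent_child, Node.parent_child, mul_assoc]
  · rw [P.phi_of_not_lt D t h, mul_one]

/-- Telescoping: the denominators `ξ` below the root are precisely the extra factors in the product
of the `φ`'s. -/
theorem markovTreeMass_post (c : Node J → State L) :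
    markovTreeMass (P.postInit D) (P.postTrans D) c =
      P.priorStates c * (∏ t, P.marg D t (c t)) / P.xi D (Node.root J) (0, 0) := by
  have hX : ∏ t : Node J, (if (t.1 : ℕ) = 0 then P.xi D (Node.root J) (0, 0)
      else P.xi D t (c t.parent)) = P.xi D (Node.root J) (0, 0) *
        ∏ t : Node J with (t.1 : ℕ) ≠ 0, P.xi D t (c t.parent) := by
    rw [Finset.prod_ite]
    congr 1
    have : (Finset.univ.filter fun t : Node J => (t.1 : ℕ) = 0) = {Node.root J} := by
      ext t
      simp only [Finset.mem_filter, Finset.mem_univ, true_and, Finset.mem_singleton]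
      exact ⟨Node.eq_root_of_level_eq_zero, fun h => by rw [h]; rfl⟩
    rw [this, Finset.prod_singleton]
  have h1 : markovTreeMass (P.postInit D) (P.postTrans D) c =
      P.priorStates c * (∏ t, P.phi D t (c t)) / ∏ t : Node J,
        (if (t.1 : ℕ) = 0 then P.xi D (Node.root J) (0, 0) else P.xi D t (c t.parent)) := by
    rw [priorStates_eq]
    unfold markovTreeMass
    rw [← Finset.prod_mul_distrib, ← Finset.prod_div_distrib]
    refine Finset.prod_congr rfl fun t _ => ?_
    split_ifs with ht
    · rw [Node.eq_root_of_level_eq_zero ht]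
      rfl
    · rfl
  have h2 : ∏ t : Node J with (t.1 : ℕ) ≠ 0, P.xi D t (c t.parent) ≠ 0 :=
    Finset.prod_ne_zero_iff.mpr fun t _ => (P.xi_pos D t _).ne'
  rw [h1, hX, P.prod_phi D c, ← mul_assoc, mul_div_mul_right _ _ h2]

end NIGMG

/-! ### Bayes' formula for a likelihood with a density -/

/-- If the likelihood has the density `f · ω` given `ω`, then the posterior is prior times
likelihood, normalized. -/
theorem posterior_ae_eq_of_withDensity {Ω X : Type*} [MeasurableSpace Ω] [MeasurableSpace X]
    [StandardBorelSpace Ω] [Nonempty Ω] (κ : Kernel Ω X) [IsFiniteKernel κ] (μ : Measure Ω)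
    [IsFiniteMeasure μ] (ν : Measure X) [SFinite ν] {f : X → Ω → ℝ≥0∞}
    (hf : Measurable (Function.uncurry f)) (hκ : ∀ᵐ ω ∂μ, κ ω = ν.withDensity fun x => f x ω)
    (h0 : ∀ x, ∫⁻ ω, f x ω ∂μ ≠ 0) (htop : ∀ x, ∫⁻ ω, f x ω ∂μ ≠ ∞) :
    ∀ᵐ x ∂(κ ∘ₘ μ), (κ†μ) x = (∫⁻ ω, f x ω ∂μ)⁻¹ • μ.withDensity (f x) := by
  have hfx : ∀ x, Measurable (f x) := fun x => hf.comp measurable_prodMk_left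
  have hfω : ∀ ω, Measurable fun x => f x ω := fun ω => hf.comp measurable_prodMk_right
  have hZ : Measurable fun x => ∫⁻ ω, f x ω ∂μ := hf.lintegral_prod_right'
  let η : Kernel X Ω := ⟨fun x => (∫⁻ ω, f x ω ∂μ)⁻¹ • μ.withDensity (f x), by
    refine Measure.measurable_of_measurable_coe _ fun s hs => ?_
    simp only [Measure.smul_apply, smul_eq_mul, withDensity_apply _ hs]
    exact hZ.inv.mul (Measurable.lintegral_prod_right' (ν := μ.restrict s) hf)⟩
  have hη : ∀ x, η x = (∫⁻ ω, f x ω ∂μ)⁻¹ • μ.withDensity (f x) := fun _ => rfl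
  have hmarkov : IsMarkovKernel η := ⟨fun x => ⟨by
    rw [hη, Measure.smul_apply, withDensity_apply _ MeasurableSet.univ, Measure.restrict_univ,
      smul_eq_mul, ENNReal.inv_mul_cancel (h0 x) (htop x)]⟩⟩
  -- By Tonelli, the marginal law of the data has the evidence as density.
  have hmix : κ ∘ₘ μ = ν.withDensity fun x => ∫⁻ ω, f x ω ∂μ := by
    ext s hs
    rw [Measure.bind_apply hs κ.aemeasurable, withDensity_apply _ hs,
      lintegral_lintegral_swap hf.aemeasurable]
    refine lintegral_congr_ae ?_
    filter_upwards [hκ] with ω hω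
    rw [hω, withDensity_apply _ hs]
  -- The joint law characterizes the posterior kernel. Both sides have density `f` with respect to
  -- `ν ⊗ μ`, because the evidence cancels the normalization.
  have key : (κ ∘ₘ μ) ⊗ₘ η = (μ ⊗ₘ κ).map Prod.swap := by
    ext s hs
    have hind : Measurable fun p : X × Ω => s.indicator (Function.uncurry f) p := hf.indicator hs
    rw [Measure.compProd_apply hs, Measure.map_apply measurable_swap hs,
      Measure.compProd_apply (measurable_swap hs), hmix,
      lintegral_withDensity_eq_lintegral_mul _ hZ (Kernel.measurable_kernel_prodMk_left hs)]
    have hl : ∀ x, ((fun x => ∫⁻ ω, f x ω ∂μ) * fun x => η x (Prod.mk x ⁻¹' s)) x =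
        ∫⁻ ω, s.indicator (Function.uncurry f) (x, ω) ∂μ := by
      intro x
      have hsx : MeasurableSet (Prod.mk x ⁻¹' s) := measurable_prodMk_left hs
      rw [Pi.mul_apply, hη, Measure.smul_apply, smul_eq_mul, ← mul_assoc,
        ENNReal.mul_inv_cancel (h0 x) (htop x), one_mul, withDensity_apply _ hsx,
        ← lintegral_indicator hsx]
      rfl
    rw [lintegral_congr hl, lintegral_lintegral_swap hind.aemeasurable]
    refine lintegral_congr_ae ?_
    filter_upwards [hκ] with ω hω
    have hsω : MeasurableSet (Prod.mk ω ⁻¹' (Prod.swap ⁻¹' s)) :=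
      measurable_prodMk_left (measurable_swap hs)
    rw [hω, withDensity_apply _ hsω, ← lintegral_indicator hsω]
    rfl
  filter_upwards [ae_eq_posterior_of_compProd_eq key] with x hx
  rw [← hx, hη]

theorem withDensity_finset_sum_measure {α ι : Type*} [MeasurableSpace α] [Fintype ι]
    (μ : ι → Measure α) (f : α → ℝ≥0∞) :
    (∑ i, μ i).withDensity f = ∑ i, (μ i).withDensity f := by
  rw [← Measure.sum_fintype, withDensity_sum, Measure.sum_fintype]

namespace NIGMG

variable {J L : ℕ} (P : NIGMG J L)

/-! ### Laws of the unknowns that are independent over the nodes given the hidden states -/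

section Grove

variable (w : (Node J → State L) → ℝ) (node : Node J → State L → Measure (ℝ × P.Theta))
  [∀ t x, IsProbabilityMeasure (node t x)]

theorem grove_apply {s : Set P.Param} (hs : MeasurableSet s) :
    P.grove w node s = ∑ c, ENNReal.ofReal (w c) *
      Measure.pi (fun t => node t (c t)) (Prod.mk c ⁻¹' s) := by
  rw [grove, Measure.finsetSum_apply]
  refine Finset.sum_congr rfl fun c _ => ?_
  rw [Measure.smul_apply, smul_eq_mul, Measure.dirac_prod,
    Measure.map_apply measurable_prodMk_left hs]

theorem grove_fst (B : Set (Node J → State L)) [DecidablePred (· ∈ B)] :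
    P.grove w node (Prod.fst ⁻¹' B) = ∑ c, if c ∈ B then ENNReal.ofReal (w c) else 0 := by
  rw [P.grove_apply w node (measurable_fst (Set.toFinite B).measurableSet)]
  refine Finset.sum_congr rfl fun c _ => ?_
  split_ifs with hc
  · have : (Prod.mk c ⁻¹' (Prod.fst ⁻¹' B) : Set (Node J → ℝ × P.Theta)) = Set.univ := by
      ext y
      simpa using hc
    rw [this, measure_univ, mul_one]
  · have : (Prod.mk c ⁻¹' (Prod.fst ⁻¹' B) : Set (Node J → ℝ × P.Theta)) = ∅ := by
      ext y
      simpa using hc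
    rw [this, measure_empty, mul_zero]

theorem grove_map_node (t : Node J) :
    (P.grove w node).map (fun p => (p.1 t, p.2 t)) =
      ∑ c, ENNReal.ofReal (w c) • (node t (c t)).map (Prod.mk (c t)) := by
  have hm : Measurable fun p : P.Param => (p.1 t, p.2 t) := by fun_prop
  ext s hs
  rw [Measure.map_apply hm hs, P.grove_apply w node (hm hs), Measure.finsetSum_apply]
  refine Finset.sum_congr rfl fun c _ => ?_
  rw [Measure.smul_apply, smul_eq_mul, Measure.map_apply measurable_prodMk_left hs,
    ← (measurePreserving_eval (fun t => node t (c t)) t).measure_preimage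
      (measurable_prodMk_left hs).nullMeasurableSet]
  rfl

/-- Given the whole configuration, the law at `t` depends only on the state of `t`, so it factors
out of the sum over configurations. -/
theorem grove_state_inter_node (t : Node J) (x : State L) {s : Set (ℝ × P.Theta)}
    (hs : MeasurableSet s) :
    P.grove w node {p | p.1 t = x ∧ p.2 t ∈ s} = P.grove w node {p | p.1 t = x} * node t x s := by
  have hm : Measurable fun p : P.Param => (p.1 t, p.2 t) := by fun_prop
  have hmap : ∀ u : Set (ℝ × P.Theta), MeasurableSet u →
      P.grove w node {p | p.1 t = x ∧ p.2 t ∈ u} =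
        ∑ c, (if c t = x then ENNReal.ofReal (w c) else 0) * node t x u := by
    intro u hu
    have hset : {p : P.Param | p.1 t = x ∧ p.2 t ∈ u} =
        (fun p : P.Param => (p.1 t, p.2 t)) ⁻¹' ({x} ×ˢ u) := by
      ext p
      simp
    have hxu : MeasurableSet (({x} : Set (State L)) ×ˢ u) :=
      (measurableSet_singleton x).prod hu
    rw [hset, ← Measure.map_apply hm hxu, P.grove_map_node, Measure.finsetSum_apply]
    refine Finset.sum_congr rfl fun c _ => ?_
    rw [Measure.smul_apply, smul_eq_mul, Measure.map_apply measurable_prodMk_left hxu]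
    split_ifs with hc
    · have : Prod.mk (c t) ⁻¹' (({x} : Set (State L)) ×ˢ u) = u := by
        ext y
        simp [hc]
      rw [this, hc]
    · have : Prod.mk (c t) ⁻¹' (({x} : Set (State L)) ×ˢ u) = ∅ := by
        ext y
        simp [hc]
      rw [this, measure_empty, mul_zero, zero_mul]
  have huniv := hmap Set.univ MeasurableSet.univ
  simp only [Set.mem_univ, and_true, measure_univ, mul_one] at huniv
  rw [hmap s hs, huniv, Finset.sum_mul]

theorem grove_map_fst :
    (P.grove w node).map Prod.fst = ∑ c, ENNReal.ofReal (w c) • Measure.dirac c := by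
  classical
  ext B hB
  rw [Measure.map_apply measurable_fst hB, P.grove_fst w node B, Measure.finsetSum_apply]
  refine Finset.sum_congr rfl fun c _ => ?_
  rw [Measure.smul_apply, smul_eq_mul, Measure.dirac_apply' _ hB]
  simp [Set.indicator]

end Grove

/-! ### The prior and the law of the data -/

theorem ae_pos_priorNode (t : Node J) (x : State L) : ∀ᵐ y ∂(P.priorNode t x), 0 < y.1 := by
  have hs : MeasurableSet {y : ℝ × P.Theta | ¬ 0 < y.1} :=
    (measurableSet_lt measurable_const measurable_fst).compl
  rw [ae_iff, priorNode, Measure.bind_apply hs (P.measurable_priorCoef_map _ x).aemeasurable]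
  refine (lintegral_congr_ae (g := fun _ => 0) ?_).trans lintegral_zero
  filter_upwards [ae_pos_invGamma _ _] with v hv
  rw [Measure.map_apply measurable_prodMk_left hs]
  have : (Prod.mk v ⁻¹' {y : ℝ × P.Theta | ¬ 0 < y.1}) = ∅ := by
    ext θ
    simp [hv]
  rw [this, measure_empty]

/-- A normal law of zero variance has no density, so the likelihood represents the data law only
where all variances are positive. -/
theorem ae_pos_prior : ∀ᵐ p ∂P.prior, ∀ t, 0 < (p.2 t).1 := by
  rw [ae_all_iff]
  intro t
  have hs : MeasurableSet {p : P.Param | ¬ 0 < (p.2 t).1} :=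
    (measurableSet_lt measurable_const
      (by fun_prop : Measurable fun p : P.Param => (p.2 t).1)).compl
  rw [ae_iff, prior, grove, Measure.finsetSum_apply]
  refine Finset.sum_eq_zero fun c _ => ?_
  rw [Measure.smul_apply, Measure.dirac_prod, Measure.map_apply measurable_prodMk_left hs,
    smul_eq_mul]
  have h : ∀ᵐ y ∂(Measure.pi fun t => P.priorNode t (c t)), 0 < (y t).1 :=
    (Measure.tendsto_eval_ae_ae (μ := fun t => P.priorNode t (c t)) (i := t)).eventually
      (P.ae_pos_priorNode t (c t))
  rw [ae_iff] at h
  exact mul_eq_zero_of_right _ h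

theorem dataLaw_eq_withDensity {p : P.Param} (hp : ∀ t, 0 < (p.2 t).1) :
    P.dataLaw p = volume.withDensity fun D => P.lik D p := by
  have hnode : ∀ t, Measure.pi (fun h => gaussianReal ((P.design *ᵥ (p.2 t).2.ofLp) h)
      (p.2 t).1.toNNReal) = (volume : Measure (P.Obs → ℝ)).withDensity
        fun d => P.nodeLik d (p.2 t) := by
    intro t
    rw [volume_pi]
    exact pi_withDensity_eq (fun _ => volume) _
      (fun h => measurable_gaussianPDF ((P.design *ᵥ (p.2 t).2.ofLp) h) (p.2 t).1.toNNReal)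
      (fun h => gaussianReal_of_var_ne_zero _ (by simpa using hp t))
  have hmeas : ∀ t, Measurable fun d : P.Obs → ℝ => P.nodeLik d (p.2 t) := by
    intro t
    have h : Measurable fun d : P.Obs → ℝ => (d, p.2 t) := measurable_prodMk_right
    have h2 := P.measurable_nodeLik_uncurry.comp h
    simp only [Function.comp_def] at h2
    exact h2
  rw [dataLaw, volume_pi]
  exact pi_withDensity_eq (fun _ => volume) _ (f := fun t d => P.nodeLik d (p.2 t))
    hmeas hnode

theorem measurable_lik_uncurry : Measurable (Function.uncurry P.lik) := by
  refine Finset.measurable_prod _ fun t _ => ?_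
  have h : Measurable fun q : P.Data × P.Param => (q.1 t, q.2.2 t) := by fun_prop
  have h2 := P.measurable_nodeLik_uncurry.comp h
  simp only [Function.comp_def] at h2
  exact h2

theorem measurable_lik (D : P.Data) : Measurable (P.lik D) := by
  have h : Measurable fun p : P.Param => (D, p) := measurable_prodMk_left
  have h2 := P.measurable_lik_uncurry.comp h
  simp only [Function.comp_def, Function.uncurry_apply_pair] at h2
  exact h2

/-! ### The posterior -/

variable (D : P.Data)

/-- For each configuration, Bayes' formula at the nodes produces the weight `∏ marg`; telescoping
converts prior weight times this product into the root `ξ` times the mass under the posterior tree.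
-/
theorem prior_withDensity_lik :
    P.prior.withDensity (P.lik D) = ENNReal.ofReal (P.xi D (Node.root J) (0, 0)) •
      P.grove (markovTreeMass (P.postInit D) (P.postTrans D)) (P.postNode D) := by
  rw [prior, grove, grove, withDensity_finset_sum_measure, Finset.smul_sum]
  refine Finset.sum_congr rfl fun c _ => ?_
  have hlik : P.lik D ∘ Prod.mk c = fun y => ∏ t, P.nodeLik (D t) (y t) := rfl
  have hpi := pi_withDensity_prod_eq_smul_pi (fun t => P.priorNode t (c t))
    (fun t => P.postNode D t (c t)) (fun t => P.measurable_nodeLik (D t))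
    (fun t => (P.marg D t (c t)).toNNReal) (fun t => P.priorNode_withDensity_nodeLik D t (c t))
  have hprod : ∏ t, (((P.marg D t (c t)).toNNReal : ℝ≥0) : ℝ≥0∞) =
      ENNReal.ofReal (∏ t, P.marg D t (c t)) :=
    (ENNReal.ofReal_prod_of_nonneg fun t _ => (P.marg_pos D t (c t)).le).symm
  have hw : 0 ≤ P.priorStates c := by
    rw [priorStates_eq]
    exact P.isStochastic_initPr_transPr.mass_nonneg c
  have hxi := P.xi_pos D (Node.root J) (0, 0)
  rw [withDensity_smul_measure, Measure.dirac_prod, Measure.dirac_prod,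
    map_withDensity_comp _ measurable_prodMk_left (P.measurable_lik D), hlik, hpi, hprod,
    Measure.map_smul, smul_smul, smul_smul, ← ENNReal.ofReal_mul hw,
    ← ENNReal.ofReal_mul hxi.le, P.markovTreeMass_post D c, mul_div_cancel₀ _ hxi.ne']

instance instIsProbabilityMeasureGrovePost : IsProbabilityMeasure
    (P.grove (markovTreeMass (P.postInit D) (P.postTrans D)) (P.postNode D)) := by
  refine ⟨?_⟩
  have h := P.isStochastic_post D
  rw [P.grove_apply _ _ MeasurableSet.univ]
  simp only [Set.preimage_univ, measure_univ, mul_one]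
  rw [← ENNReal.ofReal_sum_of_nonneg fun c _ => h.mass_nonneg c, h.sum_mass, ENNReal.ofReal_one]

theorem lintegral_lik_prior :
    ∫⁻ p, P.lik D p ∂P.prior = ENNReal.ofReal (P.xi D (Node.root J) (0, 0)) := by
  have h := congrArg (fun μ => μ Set.univ) (P.prior_withDensity_lik D)
  simpa using h

theorem bayes_eq_grove :
    P.bayes D = P.grove (markovTreeMass (P.postInit D) (P.postTrans D)) (P.postNode D) := by
  rw [bayes, P.lintegral_lik_prior, P.prior_withDensity_lik, smul_smul, ENNReal.inv_mul_cancel,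
    one_smul]
  · exact (ENNReal.ofReal_pos.mpr (P.xi_pos D _ _)).ne'
  · exact ENNReal.ofReal_ne_top

theorem posterior_ae_eq_bayes :
    ∀ᵐ D ∂(P.likelihood ∘ₘ P.prior), (P.likelihood†P.prior) D = P.bayes D := by
  refine posterior_ae_eq_of_withDensity P.likelihood P.prior volume P.measurable_lik_uncurry
    ?_ (fun D => ?_) (fun D => ?_)
  · filter_upwards [P.ae_pos_prior] with p hp
    exact P.dataLaw_eq_withDensity hp
  · rw [P.lintegral_lik_prior]
    exact (ENNReal.ofReal_pos.mpr (P.xi_pos D _ _)).ne'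
  · rw [P.lintegral_lik_prior]
    exact ENNReal.ofReal_ne_top

/-! ### Marginal and conditional laws under the posterior -/

theorem bayes_fst (B : Set (Node J → State L)) [DecidablePred (· ∈ B)] :
    P.bayes D (Prod.fst ⁻¹' B) = ENNReal.ofReal
      (∑ c, if c ∈ B then markovTreeMass (P.postInit D) (P.postTrans D) c else 0) := by
  have h := (P.isStochastic_post D).mass_nonneg
  rw [bayes_eq_grove, grove_fst, ENNReal.ofReal_sum_of_nonneg]
  · refine Finset.sum_congr rfl fun c _ => ?_
    split_ifs <;> simp
  · intro c _
    split_ifs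
    · exact h c
    · exact le_rfl

theorem bayes_root (x : State L) :
    P.bayes D {p | p.1 (Node.root J) = x} = ENNReal.ofReal (P.postInit D x) := by
  rw [← (P.isStochastic_post D).sum_mass_root x]
  exact P.bayes_fst D {c | c (Node.root J) = x}

theorem cond_bayes_transition {t : Node J} (ht : (t.1 : ℕ) ≠ 0) (x x' : State L)
    (h0 : P.bayes D {p | p.1 t.parent = x} ≠ 0) :
    cond (P.bayes D) {p | p.1 t.parent = x} {p | p.1 t = x'} =
      ENNReal.ofReal (P.postTrans D t x x') := by
  have hst := P.isStochastic_post D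
  have hm : MeasurableSet {p : P.Param | p.1 t.parent = x} :=
    (by fun_prop : Measurable fun p : P.Param => p.1 t.parent) (measurableSet_singleton x)
  have h1 : P.bayes D ({p | p.1 t.parent = x} ∩ {p | p.1 t = x'}) =
      ENNReal.ofReal (P.postTrans D t x x') * P.bayes D {p | p.1 t.parent = x} := by
    have e1 := P.bayes_fst D {c | c t.parent = x ∧ c t = x'}
    have e2 := P.bayes_fst D {c | c t.parent = x}
    simp only [Set.mem_ofPred_eq] at e1 e2
    rw [hst.sum_mass_transition ht, ENNReal.ofReal_mul ((hst.2.2 t ht x).1 x'), ← e2] at e1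
    exact e1
  rw [cond_apply hm, h1, mul_comm, mul_assoc, ENNReal.mul_inv_cancel h0 (measure_ne_top _ _),
    mul_one]

theorem cond_bayes_variance (t : Node J) (x : State L) (h0 : P.bayes D {p | p.1 t = x} ≠ 0) :
    (cond (P.bayes D) {p | p.1 t = x}).map (fun p => (p.2 t).1) = P.postVar D t x := by
  have hm : MeasurableSet {p : P.Param | p.1 t = x} :=
    (by fun_prop : Measurable fun p : P.Param => p.1 t) (measurableSet_singleton x)
  ext s hs
  have h1 : P.bayes D ({p | p.1 t = x} ∩ (fun p : P.Param => (p.2 t).1) ⁻¹' s) =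
      P.bayes D {p | p.1 t = x} * P.postVar D t x s := by
    rw [← postNode_map_fst, Measure.map_apply measurable_fst hs, bayes_eq_grove]
    exact P.grove_state_inter_node _ _ t x (measurable_fst hs)
  rw [Measure.map_apply (by fun_prop) hs, cond_apply hm, h1, ← mul_assoc,
    ENNReal.inv_mul_cancel h0 (measure_ne_top _ _), one_mul]

/-- The law of the coefficients given the variance and the state of a node, as a Markov kernel in
both. -/
noncomputable def postCoefStateKernel (t : Node J) : Kernel (ℝ × State L) P.Theta :=
  ⟨fun vx => P.postCoefKernel D t vx.2 vx.1,
    measurable_from_prod_countable_left fun x => (P.postCoefKernel D t x).measurable⟩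

instance instIsMarkovKernelPostCoefStateKernel (t : Node J) :
    IsMarkovKernel (P.postCoefStateKernel D t) :=
  ⟨fun vx => by
    change IsProbabilityMeasure (P.postCoefKernel D t vx.2 vx.1)
    infer_instance⟩

theorem bayes_map_variance_state_eq_sum (t : Node J) :
    (P.bayes D).map (fun p => ((p.2 t).1, p.1 t)) =
      ∑ c, ENNReal.ofReal (markovTreeMass (P.postInit D) (P.postTrans D) c) •
        (P.postVar D t (c t)).map (fun v => (v, c t)) := by
  have hm : Measurable fun q : State L × (ℝ × P.Theta) => (q.2.1, q.1) := by fun_prop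
  have hm' : Measurable fun p : P.Param => (p.1 t, p.2 t) := by fun_prop
  have h : (fun p : P.Param => ((p.2 t).1, p.1 t)) =
      (fun q : State L × (ℝ × P.Theta) => (q.2.1, q.1)) ∘ fun p => (p.1 t, p.2 t) := rfl
  rw [h, ← Measure.map_map hm hm', bayes_eq_grove, grove_map_node]
  ext s hs
  rw [Measure.map_apply hm hs, Measure.finsetSum_apply, Measure.finsetSum_apply]
  refine Finset.sum_congr rfl fun c _ => ?_
  rw [Measure.smul_apply, Measure.smul_apply, Measure.map_apply measurable_prodMk_left (hm hs),
    ← postNode_map_fst, Measure.map_map (by fun_prop) measurable_fst,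
    Measure.map_apply (by fun_prop) hs]
  rfl

/-- For each configuration the law at `t` disintegrates through the same kernel, which sees the
configuration only via the state of `t`; mixing over configurations preserves the disintegration. -/
theorem bayes_map_eq_compProd (t : Node J) :
    (P.bayes D).map (fun p => (((p.2 t).1, p.1 t), (p.2 t).2)) =
      (P.bayes D).map (fun p => ((p.2 t).1, p.1 t)) ⊗ₘ P.postCoefStateKernel D t := by
  have hm : Measurable fun q : State L × (ℝ × P.Theta) => ((q.2.1, q.1), q.2.2) := by fun_prop
  have hm' : Measurable fun p : P.Param => (p.1 t, p.2 t) := by fun_prop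
  have h : (fun p : P.Param => (((p.2 t).1, p.1 t), (p.2 t).2)) =
      (fun q : State L × (ℝ × P.Theta) => ((q.2.1, q.1), q.2.2)) ∘ fun p => (p.1 t, p.2 t) := rfl
  ext s hs
  rw [Measure.compProd_apply hs, bayes_map_variance_state_eq_sum, lintegral_finsetSum_measure, h,
    ← Measure.map_map hm hm', bayes_eq_grove, grove_map_node, Measure.map_apply hm hs,
    Measure.finsetSum_apply]
  refine Finset.sum_congr rfl fun c _ => ?_
  rw [Measure.smul_apply, lintegral_smul_measure, Measure.map_apply measurable_prodMk_left (hm hs),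
    postNode_eq_compProd, Measure.compProd_apply (measurable_prodMk_left (hm hs)),
    lintegral_map (Kernel.measurable_kernel_prodMk_left hs) (by fun_prop)]
  rfl

/-- Uniqueness of disintegrations gives the kernel, and almost sure positivity of the variance
identifies it with the stated normal law. -/
theorem condDistrib_coef (t : Node J) :
    ∀ᵐ vx ∂((P.bayes D).map fun p => ((p.2 t).1, p.1 t)),
      condDistrib (fun p : P.Param => (p.2 t).2) (fun p => ((p.2 t).1, p.1 t)) (P.bayes D) vx =
        P.postCoef D t vx.2 vx.1 := by
  have h1 := condDistrib_ae_eq_of_measure_eq_compProd (μ := P.bayes D)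
    (Y := fun p : P.Param => (p.2 t).2) (fun p : P.Param => ((p.2 t).1, p.1 t))
    (by fun_prop) (P.bayes_map_eq_compProd D t)
  have h2 : ∀ᵐ vx ∂((P.bayes D).map fun p => ((p.2 t).1, p.1 t)), 0 < vx.1 := by
    have hs : MeasurableSet {vx : ℝ × State L | ¬ 0 < vx.1} :=
      (measurableSet_lt measurable_const measurable_fst).compl
    rw [ae_iff, bayes_map_variance_state_eq_sum, Measure.finsetSum_apply]
    refine Finset.sum_eq_zero fun c _ => ?_
    rw [Measure.smul_apply, Measure.map_apply (by fun_prop) hs, smul_eq_mul]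
    have h := ae_pos_invGamma (P.ν + 1 + (P.n : ℝ) / 2) (P.ν * P.σ₀ ^ 2 + P.Ups t.1 (D t) (c t))
    rw [ae_iff] at h
    exact mul_eq_zero_of_right _ h
  filter_upwards [h1, h2] with vx hvx hpos
  rw [hvx]
  exact P.postCoefKernel_apply D t vx.2 hpos

end NIGMG

/-! ### The main theorem -/

theorem theoremS2 {J L : ℕ} (P : NIGMG J L) :
    -- for almost all data, Bayes' formula gives the conditional law of the unknowns
    (∀ᵐ D ∂(P.likelihood ∘ₘ P.prior), (P.likelihood†P.prior) D = P.bayes D) ∧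
    ∀ D : P.Data,
      IsProbabilityMeasure (P.bayes D) ∧
      -- `m` is the marginal likelihood of the model at a node given its state
      (∀ t x, ∫⁻ y, P.nodeLik (D t) y ∂(P.priorNode t x) = ENNReal.ofReal (P.marg D t x)) ∧
      -- the maps `φ` and `ξ` are nonnegative and satisfy the pyramid recursion
      (∀ t x, 0 ≤ P.phi D t x ∧ 0 ≤ P.xi D t x) ∧
      (∀ (t : Node J) (h : (t.1 : ℕ) < J) (x : State L),
        P.phi D t x = P.marg D t x * P.xi D (t.child h 0) x * P.xi D (t.child h 1) x) ∧
      (∀ t : Node J, (t.1 : ℕ) = J → ∀ x, P.phi D t x = P.marg D t x) ∧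
      -- the hidden states form a Markov tree
      IsStochastic (P.postInit D) (P.postTrans D) ∧
      (P.bayes D).map Prod.fst = markovTree (P.postInit D) (P.postTrans D) ∧
      -- state transition probabilities
      (∀ t : Node J, (t.1 : ℕ) ≠ 0 → ∀ x x' : State L,
        P.bayes D {p | p.1 t.parent = x} ≠ 0 →
        cond (P.bayes D) {p | p.1 t.parent = x} {p | p.1 t = x'} =
          ENNReal.ofReal
            (P.ρ t x.1 x'.1 * (∏ l, P.κ t (x.2 l) (x'.2 l)) * (P.phi D t x' / P.xi D t x))) ∧
      -- initial state probabilities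
      (∀ x : State L, P.bayes D {p | p.1 (Node.root J) = x} =
        ENNReal.ofReal (P.ρ₀ x.1 * (∏ l, P.κ₀ (x.2 l)) *
          (P.phi D (Node.root J) x / P.xi D (Node.root J) (0, 0)))) ∧
      -- the variance at a node given the state of the node
      (∀ (t : Node J) (x : State L), P.bayes D {p | p.1 t = x} ≠ 0 →
        (cond (P.bayes D) {p | p.1 t = x}).map (fun p => (p.2 t).1) =
          invGamma (P.ν + 1 + (P.n : ℝ) / 2) (P.ν * P.σ₀ ^ 2 + P.Ups t.1 (D t) x)) ∧
      -- the coefficients at a node given the variance and the state of the node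
      (∀ t : Node J, ∀ᵐ vx ∂((P.bayes D).map fun p => ((p.2 t).1, p.1 t)),
        condDistrib (fun p : P.Param => (p.2 t).2) (fun p => ((p.2 t).1, p.1 t)) (P.bayes D) vx =
          multivariateGaussian (WithLp.toLp 2 (P.muStar t.1 (D t) vx.2))
            (vx.1 • (P.maskMat vx.2 ⊙ (P.LamStar t.1 vx.2)⁻¹))) ∧
      -- together: given the hidden states, the nodes are independent
      P.bayes D =
        P.grove (markovTreeMass (P.postInit D) (P.postTrans D)) (P.postNode D) := by
  refine ⟨P.posterior_ae_eq_bayes, fun D => ?_⟩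
  refine ⟨?_, P.lintegral_nodeLik_priorNode D, fun t x => ⟨(P.phi_pos D t x).le, (P.xi_pos D t x).le⟩,
    P.phi_of_lt D, fun t ht x => P.phi_of_not_lt D t (by omega) x, P.isStochastic_post D, ?_, ?_, ?_,
    P.cond_bayes_variance D, P.condDistrib_coef D, P.bayes_eq_grove D⟩
  · rw [P.bayes_eq_grove]
    infer_instance
  · rw [P.bayes_eq_grove]
    exact P.grove_map_fst _ _
  · intro t ht x x' h0
    rw [P.cond_bayes_transition D ht x x' h0, NIGMG.postTrans, mul_div_assoc]
    rfl
  · intro x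
    rw [P.bayes_root, NIGMG.postInit, mul_div_assoc]
    rfl
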